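/- Let $d\in\{2,3\}$, $\kappa>0$, and let $G$ be the Green function of the Helmholtz equation with wavenumber $\kappa$: for $x\ne y$ in $\mathbb{R}^d$, $$G(x,y)=\frac{i}{4}H_0^{(1)}(\kappa|x-y|)\ \text{ if } d=2,\qquad G(x,y)=\frac{e^{i\kappa|x-y|}}{4\pi|x-y|}\ \text{ if } d=3,$$ where $H_0^{(1)}=J_0+iY_0$ is the Hankel function of the first kind of order zero. With $\gamma$ denoting Euler's constant, let, for $t>0$, $$\phi(t)=\frac14\min\left(\sqrt{1+\tfrac{4}{\pi^2}\big(\gamma+\log(\kappa t/2)\big)^2},\sqrt{\tfrac{2}{\pi\kappa t}}\right)\ \text{ if } d=2,\qquad \phi(t)=\frac{1}{4\pi t}\ \text{ if } d=3.$$ Consider $s$ point scatterers with nonzero intensities $a=(a_1,\dots,a_s)\in(\mathbb{C}\setminus\{0\})^s$ and pairwise distinct locations $x=(x_1,\dots,x_s)\in(\mathbb{R}^d)^s$. For an incident direction $\theta\in\mathbb{S}^{d-1}$, the Foldy-Lax system for $u=(u_i)_{1\le i\le s}\in\mathbb{C}^s$ is $$u_i=e^{i\kappa\theta\cdot x_i}+\kappa^2\sum_{j\ne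 i}G(x_i,x_j)a_ju_j,\qquad 1\le i\le s.$$ The far field pattern and its Born approximation are, for $(\hat x,\theta)\in\mathbb{S}^{d-1}\times\mathbb{S}^{d-1}$, $$u^\infty(\hat x,\theta)=\frac{\kappa^2}{4\pi}\sum_{i=1}^s a_iu_ie^{-i\kappa\hat x\cdot x_i},\qquad u^{\infty,b}(\hat x,\theta)=\frac{\kappa^2}{4\pi}\sum_{i=1}^s a_ie^{-i\kappa(\hat x-\theta)\cdot x_i},$$ where $u$ solves the Foldy-Lax system with incident direction $\theta$. Let $\Delta=\min_{i\ne j}|x_i-x_j|$, $a_{-i}=(a_1,\dots,a_{i-1},a_{i+1},\dots,a_s)$ and $\alpha=\kappa^2\phi(\Delta)\max_i\|a_{-i}\|_1$ (with $\alpha=0$ if $s\le1$). If $\alpha<1$, then for every $\theta\in\mathbb{S}^{d-1}$ the Foldy-Lax system has exactly one solution, so that $u^\infty$ is well defined, and $$\|u^\infty-u^{\infty,b}\|_\infty\le\frac{\kappa^2}{4\pi}\|a\|_1\frac{\alpha}{1-\alpha},$$ $$\|u^\infty-u^{\infty,b}\|_\infty\le\frac{\kappa^2}{4\pi}\left(\|a\|_1\frac{\alpha^2}{1-\alpha}+2\sum_{i<j}|a_i||a_j|\kappa^2\phi(|x_i-x_j|)\right),$$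 where $\|\cdot\|_\infty$ is the supremum norm over $\mathbb{S}^{d-1}\times\mathbb{S}^{d-1}$. Moreover the second bound is finer than the first: its right-hand side is at most that of the first. -/

import Mathlib

namespace FoldyLax

open scoped ENNReal

noncomputable section

/-- Bessel function of the first kind of order zero,
`J₀(t) = ∑ₖ (-1)ᵏ (t²/4)ᵏ / (k!)²`. -/
def besselJ0 (t : ℝ) : ℝ :=
  ∑' k : ℕ, (-1) ^ k * (t ^ 2 / 4) ^ k / (k.factorial : ℝ) ^ 2

/-- Bessel function of the second kind (Neumann function) of order zero, for `t > 0`: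
`Y₀(t) = (2/π) (log (t/2) + γ) J₀(t) - (2/π) ∑ₖ (-1)ᵏ Hₖ (t²/4)ᵏ / (k!)²`,
where `Hₖ` is the `k`-th harmonic number and `γ` is Euler's constant. -/
def besselY0 (t : ℝ) : ℝ :=
  2 / Real.pi * (Real.log (t / 2) + Real.eulerMascheroniConstant) * besselJ0 t
    - 2 / Real.pi *
      ∑' k : ℕ, (-1) ^ k * (harmonic k : ℝ) * (t ^ 2 / 4) ^ k / (k.factorial : ℝ) ^ 2

/-- Hankel function of the first kind of order zero, `H₀⁽¹⁾ = J₀ + i Y₀`, on `t > 0`. -/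
def hankelH0 (t : ℝ) : ℂ := (besselJ0 t : ℂ) + Complex.I * (besselY0 t : ℂ)

/-- Green function of the Helmholtz equation with wavenumber `κ` in dimension `d ∈ {2, 3}`,
at two distinct points. -/
def green {d : ℕ} (κ : ℝ) (x y : EuclideanSpace ℝ (Fin d)) : ℂ :=
  if d = 2 then Complex.I / 4 * hankelH0 (κ * ‖x - y‖)
  else 1 / (4 * (Real.pi : ℂ) * (‖x - y‖ : ℂ)) *
    Complex.exp (Complex.I * (κ : ℂ) * (‖x - y‖ : ℂ))

/-- The function `φ` on `t > 0`, in dimension `d ∈ {2, 3}`. -/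
def phi (d : ℕ) (κ t : ℝ) : ℝ :=
  if d = 2 then
    1 / 4 * min
      (Real.sqrt (1 + 4 / Real.pi ^ 2 *
        (Real.eulerMascheroniConstant + Real.log (κ * t / 2)) ^ 2))
      (Real.sqrt (2 / (Real.pi * κ * t)))
  else 1 / (4 * Real.pi * t)

/-- The unit sphere of `ℝᵈ`: the set of (incident or observation) directions. -/
abbrev Direction (d : ℕ) : Type := Metric.sphere (0 : EuclideanSpace ℝ (Fin d)) 1

/-- Incident plane wave `y ↦ exp (i κ θ·y)`. -/
def incident {d : ℕ} (κ : ℝ) (θ : Direction d) (y : EuclideanSpace ℝ (Fin d)) : ℂ :=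
  Complex.exp (Complex.I * (κ : ℂ) * (inner ℝ (θ : EuclideanSpace ℝ (Fin d)) y : ℂ))

/-- `u` solves the Foldy-Lax system of the scatterers with intensities `a` and locations `x`,
for the incident direction `θ`. -/
def IsFoldySolution {d s : ℕ} (κ : ℝ) (a : Fin s → ℂ) (x : Fin s → EuclideanSpace ℝ (Fin d))
    (θ : Direction d) (u : Fin s → ℂ) : Prop :=
  ∀ i, u i = incident κ θ (x i)
    + (κ : ℂ) ^ 2 * ∑ j ∈ Finset.univ.erase i, green κ (x i) (x j) * a j * u j

/-- Far field pattern `u^∞ (x̂, θ)`, where `u θ` are the coefficients at the scatterers for the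
incident direction `θ`. The pair `p` is `(x̂, θ)`. -/
def farField {d s : ℕ} (κ : ℝ) (a : Fin s → ℂ) (x : Fin s → EuclideanSpace ℝ (Fin d))
    (u : Direction d → Fin s → ℂ) (p : Direction d × Direction d) : ℂ :=
  (κ : ℂ) ^ 2 / (4 * (Real.pi : ℂ)) * ∑ i, a i * u p.2 i *
    Complex.exp (-(Complex.I * (κ : ℂ) * (inner ℝ (p.1 : EuclideanSpace ℝ (Fin d)) (x i) : ℂ)))

/-- Far field pattern `u^{∞,b} (x̂, θ)` in the Born approximation. -/
def farFieldBorn {d s : ℕ} (κ : ℝ) (a : Fin s → ℂ) (x : Fin s → EuclideanSpace ℝ (Fin d))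
    (p : Direction d × Direction d) : ℂ :=
  (κ : ℂ) ^ 2 / (4 * (Real.pi : ℂ)) * ∑ i, a i *
    Complex.exp (-(Complex.I * (κ : ℂ) *
      (inner ℝ ((p.1 : EuclideanSpace ℝ (Fin d)) - (p.2 : EuclideanSpace ℝ (Fin d))) (x i) : ℂ)))

/-- Supremum norm of a complex-valued function, as an extended nonnegative real. -/
def supNorm {X : Type*} (f : X → ℂ) : ℝ≥0∞ := ⨆ p, ‖f p‖ₑ

/-- The norm `‖a‖₁`. -/
def l1Norm {s : ℕ} (a : Fin s → ℂ) : ℝ := ∑ i, ‖a i‖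

/-- Minimal separation `Δ = min_{i ≠ j} |x_i - x_j|`: for `s ≥ 2` the infimum of a finite nonempty
family, hence a minimum. For `s ≤ 1` its value is irrelevant, since it is only used multiplied by
`max_i ‖a_{-i}‖₁ = 0`. -/
def separation {d s : ℕ} (x : Fin s → EuclideanSpace ℝ (Fin d)) : ℝ :=
  ⨅ p : {p : Fin s × Fin s // p.1 ≠ p.2}, ‖x p.1.1 - x p.1.2‖

/-- `max_i ‖a_{-i}‖₁`, where `a_{-i}` is `a` with its `i`-th entry removed. -/
def maxRemovedL1 {s : ℕ} (a : Fin s → ℂ) : ℝ := ⨆ i, ∑ j ∈ Finset.univ.erase i, ‖a j‖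

/-- `α = κ² φ(Δ) max_i ‖a_{-i}‖₁`. -/
def alpha {d s : ℕ} (κ : ℝ) (a : Fin s → ℂ) (x : Fin s → EuclideanSpace ℝ (Fin d)) : ℝ :=
  κ ^ 2 * phi d κ (separation x) * maxRemovedL1 a

/-- `2 ∑_{i<j} |a_i| |a_j| κ² φ(|x_i - x_j|)`. -/
def pairInteraction {d s : ℕ} (κ : ℝ) (a : Fin s → ℂ)
    (x : Fin s → EuclideanSpace ℝ (Fin d)) : ℝ :=
  2 * ∑ i, ∑ j ∈ Finset.Ioi i, ‖a i‖ * ‖a j‖ * κ ^ 2 * phi d κ ‖x i - x j‖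

end

end FoldyLax

namespace FoldyLax

open Filter Topology Set MeasureTheory

/-- Coefficients of `J₀` in the variable `t ^ 2 / 4`. -/
noncomputable def coeffJ (k : ℕ) : ℝ := (-1) ^ k / (k.factorial : ℝ) ^ 2

/-- Coefficients of the non-logarithmic part of `Y₀` in the variable `t ^ 2 / 4`. -/
noncomputable def coeffY (k : ℕ) : ℝ := (-1) ^ k * (harmonic k : ℝ) / (k.factorial : ℝ) ^ 2

lemma harmonic_cast_nonneg (k : ℕ) : (0 : ℝ) ≤ (harmonic k : ℝ) := by
  induction k with
  | zero => simp
  | succ k ih => rw [harmonic_succ]; push_cast; positivity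

lemma harmonic_cast_le (k : ℕ) : (harmonic k : ℝ) ≤ k := by
  induction k with
  | zero => simp
  | succ k ih =>
    rw [harmonic_succ]; push_cast
    have : ((k : ℝ) + 1)⁻¹ ≤ 1 := inv_le_one_of_one_le₀ (by linarith [k.cast_nonneg (α := ℝ)])
    linarith

lemma cast_le_two_pow (k : ℕ) : (k : ℝ) ≤ 2 ^ k := by
  exact_mod_cast Nat.lt_two_pow_self.le

lemma one_le_factorial_cast (k : ℕ) : (1 : ℝ) ≤ (k.factorial : ℝ) := by
  exact_mod_cast Nat.one_le_of_lt k.factorial_pos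

lemma div_factorial_sq_le {k : ℕ} {x : ℝ} (hx : x ≤ 4 ^ k) :
    x / (k.factorial : ℝ) ^ 2 ≤ 4 ^ k / (k.factorial : ℝ) := by
  have h := one_le_factorial_cast k
  have h' : (k.factorial : ℝ) ≤ (k.factorial : ℝ) ^ 2 := by nlinarith
  calc x / (k.factorial : ℝ) ^ 2 ≤ 4 ^ k / (k.factorial : ℝ) ^ 2 := by gcongr
    _ ≤ _ := by gcongr

lemma abs_coeffJ (k : ℕ) : |coeffJ k| = 1 / (k.factorial : ℝ) ^ 2 := by
  simp [coeffJ, abs_div]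

lemma abs_coeffY (k : ℕ) : |coeffY k| = (harmonic k : ℝ) / (k.factorial : ℝ) ^ 2 := by
  simp [coeffY, abs_div, abs_mul, abs_of_nonneg (harmonic_cast_nonneg k)]

lemma cast_sq_le_four_pow (k : ℕ) : (k : ℝ) * k ≤ 4 ^ k := by
  have h := cast_le_two_pow k
  have h4 : (4 : ℝ) ^ k = 2 ^ k * 2 ^ k := by rw [← mul_pow]; norm_num
  rw [h4]; gcongr

lemma cast_le_four_pow (k : ℕ) : (k : ℝ) ≤ 4 ^ k :=
  (cast_le_two_pow k).trans (pow_le_pow_left₀ (by norm_num) (by norm_num) k)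

lemma abs_coeffJ_le (k : ℕ) : |coeffJ k| ≤ 4 ^ k / (k.factorial : ℝ) := by
  rw [abs_coeffJ]; exact div_factorial_sq_le (one_le_pow₀ (by norm_num))

lemma abs_mul_coeffJ_le (k : ℕ) : |(k : ℝ) * coeffJ k| ≤ 4 ^ k / (k.factorial : ℝ) := by
  rw [abs_mul, abs_coeffJ, Nat.abs_cast, mul_one_div]
  exact div_factorial_sq_le (cast_le_four_pow k)

lemma abs_coeffY_le (k : ℕ) : |coeffY k| ≤ 4 ^ k / (k.factorial : ℝ) := by
  rw [abs_coeffY]; exact div_factorial_sq_le ((harmonic_cast_le k).trans (cast_le_four_pow k))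

lemma abs_mul_coeffY_le (k : ℕ) : |(k : ℝ) * coeffY k| ≤ 4 ^ k / (k.factorial : ℝ) := by
  rw [abs_mul, abs_coeffY, Nat.abs_cast, ← mul_div_assoc]
  refine div_factorial_sq_le (le_trans ?_ (cast_sq_le_four_pow k))
  gcongr; exact harmonic_cast_le k

lemma summable_pow_series {c : ℕ → ℝ} (hc : ∀ k, |c k| ≤ 4 ^ k / (k.factorial : ℝ)) (x : ℝ) :
    Summable fun k => c k * x ^ k := by
  refine Summable.of_norm_bounded (Real.summable_pow_div_factorial (4 * |x|)) fun k => ?_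
  rw [Real.norm_eq_abs, abs_mul, abs_pow, mul_pow, mul_div_right_comm]
  gcongr; exact hc k

lemma summable_majorant (R : ℝ) :
    Summable fun k : ℕ => (k : ℝ) * (4 ^ k / (k.factorial : ℝ)) * R ^ (k - 1) := by
  rw [← summable_nat_add_iff 1]
  refine ((Real.summable_pow_div_factorial (4 * R)).mul_left 4).congr fun k => ?_
  have := k.factorial_ne_zero
  rw [Nat.factorial_succ]; push_cast
  rw [mul_pow]; field_simp; ring

lemma abs_deriv_term_le {c : ℕ → ℝ} (hc : ∀ k, |c k| ≤ 4 ^ k / (k.factorial : ℝ)) {x R : ℝ}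
    (hx : |x| ≤ R) (k : ℕ) :
    ‖(k : ℝ) * c k * x ^ (k - 1)‖ ≤ (k : ℝ) * (4 ^ k / (k.factorial : ℝ)) * R ^ (k - 1) := by
  rw [Real.norm_eq_abs, abs_mul, abs_mul, abs_pow, Nat.abs_cast]
  gcongr; exact hc k

lemma summable_deriv_series {c : ℕ → ℝ} (hc : ∀ k, |c k| ≤ 4 ^ k / (k.factorial : ℝ)) (x : ℝ) :
    Summable fun k : ℕ => (k : ℝ) * c k * x ^ (k - 1) :=
  Summable.of_norm_bounded (summable_majorant |x|) fun k => abs_deriv_term_le hc le_rfl k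

lemma hasDerivAt_pow_series {c : ℕ → ℝ} (hc : ∀ k, |c k| ≤ 4 ^ k / (k.factorial : ℝ)) (x : ℝ) :
    HasDerivAt (fun z => ∑' k, c k * z ^ k) (∑' k : ℕ, (k : ℝ) * c k * x ^ (k - 1)) x := by
  have hx : x ∈ Metric.ball (0 : ℝ) (|x| + 1) := by simp
  refine hasDerivAt_tsum_of_isPreconnected (summable_majorant (|x| + 1)) Metric.isOpen_ball
    (convex_ball _ _).isPreconnected (g := fun k z => c k * z ^ k)
    (g' := fun k z => (k : ℝ) * c k * z ^ (k - 1)) ?_ ?_ hx (summable_pow_series hc x) hx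
  · intro k y _
    exact ((hasDerivAt_pow k y).const_mul (c k)).congr_deriv (by ring)
  · intro k y hy
    exact abs_deriv_term_le hc (by simpa using (mem_ball_zero_iff.1 hy).le) k

lemma tsum_mul_index (c : ℕ → ℝ) (x : ℝ) :
    ∑' k : ℕ, (k : ℝ) * c k * x ^ k = x * ∑' k : ℕ, (k : ℝ) * c k * x ^ (k - 1) := by
  rw [← tsum_mul_left]
  refine tsum_congr fun k => ?_
  cases k with
  | zero => simp
  | succ k => rw [Nat.add_sub_cancel, pow_succ]; ring

lemma tsum_index_sq_coeffJ (x : ℝ) :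
    ∑' k : ℕ, (k : ℝ) * (k * coeffJ k) * x ^ (k - 1) = -∑' k, coeffJ k * x ^ k := by
  rw [(summable_deriv_series abs_mul_coeffJ_le x).tsum_eq_zero_add, ← tsum_neg]
  simp only [Nat.cast_zero, zero_mul, zero_add, Nat.add_sub_cancel]
  refine tsum_congr fun k => ?_
  have := k.factorial_ne_zero
  have : (k : ℝ) + 1 ≠ 0 := by positivity
  simp only [coeffJ, Nat.factorial_succ]; push_cast
  field_simp; ring

lemma tsum_index_sq_coeffY (x : ℝ) :
    ∑' k : ℕ, (k : ℝ) * (k * coeffY k) * x ^ (k - 1) =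
      -∑' k, coeffY k * x ^ k + ∑' k : ℕ, (k : ℝ) * coeffJ k * x ^ (k - 1) := by
  rw [(summable_deriv_series abs_mul_coeffY_le x).tsum_eq_zero_add, ← tsum_neg,
    (summable_deriv_series abs_coeffJ_le x).tsum_eq_zero_add]
  simp only [Nat.cast_zero, zero_mul, zero_add, Nat.add_sub_cancel]
  have hJ := (summable_nat_add_iff 1).2 (summable_deriv_series abs_coeffJ_le x)
  simp only [Nat.add_sub_cancel] at hJ
  rw [← Summable.tsum_add (summable_pow_series abs_coeffY_le x).neg hJ]
  refine tsum_congr fun k => ?_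
  have := k.factorial_ne_zero
  have : (k : ℝ) + 1 ≠ 0 := by positivity
  simp only [coeffJ, coeffY, Nat.factorial_succ, harmonic_succ]; push_cast
  field_simp; ring

lemma besselJ0_eq (t : ℝ) : besselJ0 t = ∑' k, coeffJ k * (t ^ 2 / 4) ^ k :=
  tsum_congr fun k => by rw [coeffJ]; ring

/-- The power series part of `Y₀`. -/
noncomputable def seriesY (t : ℝ) : ℝ := ∑' k, coeffY k * (t ^ 2 / 4) ^ k

/-- The Euler derivative `t J₀'(t)`. -/
noncomputable def eulerJ (t : ℝ) : ℝ := 2 * ∑' k : ℕ, (k : ℝ) * coeffJ k * (t ^ 2 / 4) ^ k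

/-- The Euler derivative of `seriesY`. -/
noncomputable def eulerSeriesY (t : ℝ) : ℝ := 2 * ∑' k : ℕ, (k : ℝ) * coeffY k * (t ^ 2 / 4) ^ k

lemma besselY0_eq (t : ℝ) : besselY0 t =
    2 / Real.pi * ((Real.log (t / 2) + Real.eulerMascheroniConstant) * besselJ0 t - seriesY t) := by
  have : seriesY t = ∑' k : ℕ, (-1) ^ k * (harmonic k : ℝ) * (t ^ 2 / 4) ^ k / (k.factorial : ℝ) ^ 2 :=
    tsum_congr fun k => by rw [coeffY]; ring
  rw [besselY0, this]; ring

lemma hasDerivAt_sq_div_four (t : ℝ) : HasDerivAt (fun t : ℝ => t ^ 2 / 4) (t / 2) t :=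
  ((hasDerivAt_pow 2 t).div_const 4).congr_deriv (by norm_num; ring)

lemma hasDerivAt_besselJ0 {t : ℝ} (ht : 0 < t) : HasDerivAt besselJ0 (eulerJ t / t) t := by
  rw [show besselJ0 = fun t => ∑' k, coeffJ k * (t ^ 2 / 4) ^ k from funext besselJ0_eq]
  refine ((hasDerivAt_pow_series abs_coeffJ_le _).comp t (hasDerivAt_sq_div_four t)).congr_deriv ?_
  rw [eulerJ, tsum_mul_index]; field_simp; ring

lemma hasDerivAt_seriesY {t : ℝ} (ht : 0 < t) : HasDerivAt seriesY (eulerSeriesY t / t) t := by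
  refine ((hasDerivAt_pow_series abs_coeffY_le _).comp t (hasDerivAt_sq_div_four t)).congr_deriv ?_
  rw [eulerSeriesY, tsum_mul_index]; field_simp; ring

lemma hasDerivAt_eulerJ (t : ℝ) : HasDerivAt eulerJ (-(t * besselJ0 t)) t := by
  refine (((hasDerivAt_pow_series abs_mul_coeffJ_le _).comp t
    (hasDerivAt_sq_div_four t)).const_mul 2).congr_deriv ?_
  rw [tsum_index_sq_coeffJ, besselJ0_eq]; ring

lemma hasDerivAt_eulerSeriesY {t : ℝ} (ht : 0 < t) :
    HasDerivAt eulerSeriesY (-(t * seriesY t) + 2 * eulerJ t / t) t := by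
  refine (((hasDerivAt_pow_series abs_mul_coeffY_le _).comp t
    (hasDerivAt_sq_div_four t)).const_mul 2).congr_deriv ?_
  rw [tsum_index_sq_coeffY, seriesY, eulerJ, tsum_mul_index]; field_simp; ring

/-- The Euler derivative `t Y₀'(t)`. -/
noncomputable def eulerY (t : ℝ) : ℝ :=
  2 / Real.pi * (besselJ0 t + (Real.log (t / 2) + Real.eulerMascheroniConstant) * eulerJ t
    - eulerSeriesY t)

lemma hasDerivAt_logTerm {t : ℝ} (ht : 0 < t) :
    HasDerivAt (fun t : ℝ => Real.log (t / 2) + Real.eulerMascheroniConstant) (1 / t) t :=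
  ((((hasDerivAt_id t).div_const 2).log (by simp; positivity)).add_const _).congr_deriv
    (by simp; field_simp)

lemma hasDerivAt_besselY0 {t : ℝ} (ht : 0 < t) : HasDerivAt besselY0 (eulerY t / t) t := by
  rw [show besselY0 = _ from funext besselY0_eq]
  refine ((((hasDerivAt_logTerm ht).mul (hasDerivAt_besselJ0 ht)).sub
    (hasDerivAt_seriesY ht)).const_mul (2 / Real.pi)).congr_deriv ?_
  rw [eulerY]; field_simp

lemma hasDerivAt_eulerY {t : ℝ} (ht : 0 < t) : HasDerivAt eulerY (-(t * besselY0 t)) t := by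
  refine ((((hasDerivAt_besselJ0 ht).add ((hasDerivAt_logTerm ht).mul (hasDerivAt_eulerJ t))).sub
    (hasDerivAt_eulerSeriesY ht)).const_mul (2 / Real.pi)).congr_deriv ?_
  rw [besselY0_eq]; field_simp; ring

lemma besselJ0_mem_Icc {t : ℝ} (h : t ^ 2 / 4 ≤ 1) : besselJ0 t ∈ Icc (1 - t ^ 2 / 4) 1 := by
  set x := t ^ 2 / 4 with hx
  have hx0 : 0 ≤ x := by positivity
  have hanti : Antitone fun k : ℕ => x ^ k / (k.factorial : ℝ) ^ 2 := by
    refine antitone_nat_of_succ_le fun k => ?_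
    have : x ^ (k + 1) ≤ x ^ k := pow_le_pow_of_le_one hx0 h k.le_succ
    gcongr
    exact k.le_succ
  have hsum := (summable_pow_series abs_coeffJ_le x).hasSum.tendsto_sum_nat
  rw [← besselJ0_eq] at hsum
  have hsum' : Tendsto (fun n => ∑ i ∈ Finset.range n, (-1) ^ i * (x ^ i / (i.factorial : ℝ) ^ 2))
      atTop (𝓝 (besselJ0 t)) :=
    hsum.congr fun n => Finset.sum_congr rfl fun i _ => by rw [coeffJ]; ring
  have h1 := hanti.tendsto_le_alternating_series hsum' 0
  have h2 := hanti.alternating_series_le_tendsto hsum' 1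
  norm_num [Finset.sum_range_succ] at h1 h2
  exact ⟨by linarith, by linarith⟩

lemma seriesY_mem_Icc {t : ℝ} (h : t ^ 2 / 4 ≤ 1) : seriesY t ∈ Icc (-(t ^ 2 / 4)) 0 := by
  set x := t ^ 2 / 4 with hx
  have hx0 : 0 ≤ x := by positivity
  set f : ℕ → ℝ := fun k => (harmonic (k + 1) : ℝ) * x ^ (k + 1) / ((k + 1).factorial : ℝ) ^ 2
  have hanti : Antitone f := by
    refine antitone_nat_of_succ_le fun k => ?_
    have hp : x ^ (k + 1 + 1) ≤ x ^ (k + 1) := pow_le_pow_of_le_one hx0 h (k + 1).le_succ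
    have hh : (harmonic (k + 1 + 1) : ℝ) ≤ 2 * harmonic (k + 1) := by
      have h0 := harmonic_cast_nonneg k
      rw [harmonic_succ (k + 1), harmonic_succ k]; push_cast
      have : ((k : ℝ) + 1 + 1)⁻¹ ≤ ((k : ℝ) + 1)⁻¹ := by gcongr; linarith
      have h1 : 0 ≤ ((k : ℝ) + 1)⁻¹ := by positivity
      linarith
    have hf : 2 * ((k + 1).factorial : ℝ) ^ 2 ≤ ((k + 1 + 1).factorial : ℝ) ^ 2 := by
      rw [Nat.factorial_succ (k + 1)]; push_cast
      rw [mul_pow]; gcongr; nlinarith [k.cast_nonneg (α := ℝ)]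
    have h0 := harmonic_cast_nonneg (k + 1)
    have hF : (0 : ℝ) < ((k + 1).factorial : ℝ) := by positivity
    calc f (k + 1) ≤ (2 * harmonic (k + 1)) * x ^ (k + 1) / (2 * ((k + 1).factorial : ℝ) ^ 2) := by
          simp only [f]; gcongr
      _ = f k := by simp only [f]; field_simp
  have hs := summable_pow_series abs_coeffY_le x
  have hval : seriesY t = -∑' k, (-1) ^ k * f k := by
    rw [seriesY, hs.tsum_eq_zero_add, ← tsum_neg]
    simp only [coeffY, f, harmonic_zero]
    norm_num
    refine tsum_congr fun k => ?_
    ring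
  have hs' : Summable fun k => (-1) ^ k * f k := by
    refine ((summable_nat_add_iff 1).2 hs).neg.congr fun k => ?_
    simp only [coeffY, f]; ring
  have hsum := hs'.hasSum.tendsto_sum_nat
  have h1 := hanti.tendsto_le_alternating_series hsum 0
  have h2 := hanti.alternating_series_le_tendsto hsum 0
  have hf0 : f 0 = x := by simp [f]
  simp only [mul_zero, zero_add, Finset.sum_range_one, Finset.sum_range_zero, pow_zero, one_mul,
    hf0] at h1 h2
  rw [hval]
  constructor <;> linarith

lemma euler_deriv_le_sq {D E : ℝ → ℝ} (hD : ∀ t, 0 < t → HasDerivAt D (E t / t) t)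
    (hE : ∀ t, 0 < t → HasDerivAt E (-(t * D t)) t) {δ : ℝ}
    (hb : ∀ t, 0 < t → t < δ → |D t| ≤ 1) {t₀ : ℝ} (h0 : 0 < t₀) (h1 : t₀ < δ) :
    E t₀ ≤ t₀ ^ 2 := by
  by_contra! hc
  set c := E t₀ - t₀ ^ 2
  have hc0 : 0 < c := sub_pos.2 hc
  have hanti : AntitoneOn (fun s => E s - t₀ * s) (Ioc 0 t₀) := by
    have hd : ∀ s, 0 < s → HasDerivAt (fun s => E s - t₀ * s) (-(s * D s) - t₀) s := fun s hs =>
      ((hE s hs).sub ((hasDerivAt_id s).const_mul t₀)).congr_deriv (by simp)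
    refine antitoneOn_of_deriv_nonpos (convex_Ioc 0 t₀)
      (fun s hs => (hd s hs.1).continuousAt.continuousWithinAt)
      (fun s hs => ?_) fun s hs => ?_
    · rw [interior_Ioc] at hs; exact (hd s hs.1).differentiableAt.differentiableWithinAt
    · rw [interior_Ioc] at hs
      rw [(hd s hs.1).deriv]
      have := abs_le.1 (hb s hs.1 (hs.2.trans h1))
      nlinarith [hs.1, hs.2]
  have hlow : ∀ t, 0 < t → t ≤ t₀ → c ≤ E t := fun t ht htt => by
    have := hanti ⟨ht, htt⟩ ⟨h0, le_rfl⟩ htt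
    simp only at this
    have : 0 < t₀ * t := by positivity
    simp only [c]; nlinarith
  have hmono : MonotoneOn (fun s => D s - c * Real.log s) (Ioc 0 t₀) := by
    have hd : ∀ s, 0 < s → HasDerivAt (fun s => D s - c * Real.log s) ((E s - c) / s) s :=
      fun s hs => ((hD s hs).sub ((Real.hasDerivAt_log hs.ne').const_mul c)).congr_deriv (by
        field_simp)
    refine monotoneOn_of_deriv_nonneg (convex_Ioc 0 t₀)
      (fun s hs => (hd s hs.1).continuousAt.continuousWithinAt)
      (fun s hs => ?_) fun s hs => ?_
    · rw [interior_Ioc] at hs; exact (hd s hs.1).differentiableAt.differentiableWithinAt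
    · rw [interior_Ioc] at hs
      rw [(hd s hs.1).deriv]
      exact div_nonneg (sub_nonneg.2 (hlow s hs.1 hs.2.le)) hs.1.le
  have hev : ∀ᶠ t in 𝓝[>] (0 : ℝ), Real.log t < (-2 - (D t₀ - c * Real.log t₀)) / c :=
    Real.tendsto_log_nhdsGT_zero.eventually (eventually_lt_atBot _)
  have hev2 : ∀ᶠ t in 𝓝[>] (0 : ℝ), t ∈ Ioo 0 t₀ := Ioo_mem_nhdsGT h0
  obtain ⟨t, ht1, ht2⟩ := (hev.and hev2).exists
  have := hmono ⟨ht2.1, ht2.2.le⟩ ⟨h0, le_rfl⟩ ht2.2.le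
  have hbt := abs_le.1 (hb t ht2.1 (ht2.2.trans h1))
  rw [lt_div_iff₀ hc0] at ht1
  simp only at this
  linarith

/-- A solution of the Bessel equation of order zero which tends to zero at the origin vanishes. -/
lemma eq_zero_of_bessel_of_tendsto {D E : ℝ → ℝ} (hD : ∀ t, 0 < t → HasDerivAt D (E t / t) t)
    (hE : ∀ t, 0 < t → HasDerivAt E (-(t * D t)) t)
    (h0 : Tendsto D (𝓝[>] 0) (𝓝 0)) {t : ℝ} (ht : 0 < t) : D t = 0 := by
  have hev : ∀ᶠ t in 𝓝[>] (0 : ℝ), |D t| < 1 := by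
    have := h0.abs
    rw [abs_zero] at this
    exact this.eventually (gt_mem_nhds one_pos)
  obtain ⟨δ, hδ, hb⟩ := mem_nhdsGT_iff_exists_Ioo_subset.1 hev
  have hδ' : (0 : ℝ) < δ := hδ
  have hb' : ∀ t, 0 < t → t < δ → |D t| ≤ 1 := fun t h1 h2 => (hb ⟨h1, h2⟩ : |D t| < 1).le
  have hEb : ∀ t, 0 < t → t < δ → |E t| ≤ t ^ 2 := fun t h1 h2 => abs_le.2 ⟨by
    have := euler_deriv_le_sq (D := fun t => -D t) (E := fun t => -E t)
      (fun t ht => (hD t ht).neg.congr_deriv (by ring))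
      (fun t ht => (hE t ht).neg.congr_deriv (by ring))
      (fun t h1 h2 => by rw [abs_neg]; exact hb' t h1 h2) h1 h2
    linarith, euler_deriv_le_sq hD hE hb' h1 h2⟩
  have hanti : AntitoneOn (fun s => (E s / s) ^ 2 + D s ^ 2) (Ioi 0) := by
    have hd : ∀ s, 0 < s → HasDerivAt (fun s => (E s / s) ^ 2 + D s ^ 2)
        (-(2 * (E s / s) ^ 2 / s)) s := fun s hs =>
      ((((hE s hs).div (hasDerivAt_id s) hs.ne').pow 2).add ((hD s hs).pow 2)).congr_deriv (by
        simp; field_simp; ring)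
    refine antitoneOn_of_deriv_nonpos (convex_Ioi 0)
      (fun s hs => (hd s hs).continuousAt.continuousWithinAt)
      (fun s hs => ?_) fun s hs => ?_
    · rw [interior_Ioi] at hs; exact (hd s hs).differentiableAt.differentiableWithinAt
    · rw [interior_Ioi] at hs
      have hs' : 0 < s := hs
      rw [(hd s hs).deriv, neg_nonpos]
      positivity
  have hlim : Tendsto (fun s => s ^ 2 + D s ^ 2) (𝓝[>] 0) (𝓝 (0 ^ 2 + 0 ^ 2)) :=
    ((tendsto_id.mono_left nhdsWithin_le_nhds).pow 2).add (h0.pow 2)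
  have hle : (E t / t) ^ 2 + D t ^ 2 ≤ 0 ^ 2 + 0 ^ 2 := by
    refine ge_of_tendsto hlim ?_
    filter_upwards [Ioo_mem_nhdsGT (lt_min ht hδ')] with s hs
    have hst := hs.2.trans_le (min_le_left _ _)
    have hsδ := hs.2.trans_le (min_le_right _ _)
    have h1 : (E t / t) ^ 2 + D t ^ 2 ≤ (E s / s) ^ 2 + D s ^ 2 := hanti hs.1 ht hst.le
    have h2 : (E s / s) ^ 2 ≤ s ^ 2 := by
      rw [sq_le_sq, abs_div, abs_of_pos hs.1, div_le_iff₀ hs.1]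
      linarith [hEb s hs.1 hsδ, sq s]
    linarith
  have h2 : D t ^ 2 ≤ 0 := by nlinarith [sq_nonneg (E t / t)]
  exact pow_eq_zero_iff (two_ne_zero) |>.1 (le_antisymm h2 (sq_nonneg _))

/-- The square root of `y + i / 2` with positive real part. -/
noncomputable def rotRoot (y : ℝ) : ℂ := Complex.exp (Complex.log (y + Complex.I / 2) / 2)

lemma add_I_half_mem_slitPlane (y : ℝ) : (y + Complex.I / 2 : ℂ) ∈ Complex.slitPlane := by
  right; simp

lemma rotRoot_sq (y : ℝ) : rotRoot y ^ 2 = y + Complex.I / 2 := by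
  rw [rotRoot, ← Complex.exp_nat_mul]
  rw [show ((2 : ℕ) : ℂ) * (Complex.log (y + Complex.I / 2) / 2) =
    Complex.log (y + Complex.I / 2) by push_cast; ring]
  exact Complex.exp_log (Complex.slitPlane_ne_zero (add_I_half_mem_slitPlane y))

lemma rotRoot_ne_zero (y : ℝ) : rotRoot y ≠ 0 := Complex.exp_ne_zero _

lemma rotRoot_re_pos (y : ℝ) : 0 < (rotRoot y).re := by
  rw [rotRoot, Complex.exp_re]
  refine mul_pos (Real.exp_pos _) (Real.cos_pos_of_mem_Ioo ?_)
  rw [Complex.div_ofNat_im, Complex.log_im]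
  have h1 := Complex.neg_pi_lt_arg (y + Complex.I / 2)
  have h2 := Complex.slitPlane_arg_ne_pi (add_I_half_mem_slitPlane y)
  have h3 := lt_of_le_of_ne (Complex.arg_le_pi (y + Complex.I / 2)) h2
  constructor <;> linarith

lemma hasDerivAt_rotRoot (y : ℝ) : HasDerivAt rotRoot (1 / (2 * rotRoot y)) y := by
  have h1 : HasDerivAt (fun y : ℝ => (y + Complex.I / 2 : ℂ)) 1 y :=
    (Complex.ofRealCLM.hasDerivAt (x := y)).add_const _
  refine ((h1.clog_real (add_I_half_mem_slitPlane y)).div_const 2).cexp.congr_deriv ?_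
  change rotRoot y * _ = _
  rw [← rotRoot_sq]
  have := rotRoot_ne_zero y
  field_simp

lemma continuous_rotRoot : Continuous rotRoot :=
  continuous_iff_continuousAt.2 fun y => (hasDerivAt_rotRoot y).continuousAt

lemma rotRoot_zero : rotRoot 0 = (1 + Complex.I) / 2 := by
  have h1 := rotRoot_sq 0
  have h2 := rotRoot_re_pos 0
  have h3 : (rotRoot 0 - (1 + Complex.I) / 2) * (rotRoot 0 + (1 + Complex.I) / 2) = 0 := by
    have : (rotRoot 0 - (1 + Complex.I) / 2) * (rotRoot 0 + (1 + Complex.I) / 2) =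
      rotRoot 0 ^ 2 - (1 + 2 * Complex.I + Complex.I ^ 2) / 4 := by ring
    rw [this, h1, Complex.I_sq]; push_cast; ring
  rcases mul_eq_zero.1 h3 with h | h
  · exact sub_eq_zero.1 h
  · have := congrArg Complex.re h
    simp at this
    linarith

lemma norm_rotRoot_sq (y : ℝ) : ‖rotRoot y‖ ^ 2 = ‖(y + Complex.I / 2 : ℂ)‖ := by
  rw [← norm_pow, rotRoot_sq]

lemma sqrt_le_norm_rotRoot (y : ℝ) : √y ≤ ‖rotRoot y‖ := by
  refine Real.sqrt_le_left (norm_nonneg _) |>.2 ?_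
  rw [norm_rotRoot_sq]
  have := Complex.re_le_norm (y + Complex.I / 2)
  simpa using this

lemma norm_rotRoot_sq_le {y : ℝ} (hy : 0 ≤ y) : ‖rotRoot y‖ ^ 2 ≤ y + 1 / 2 := by
  rw [norm_rotRoot_sq]
  refine (norm_add_le _ _).trans ?_
  simp [abs_of_nonneg hy]

/-- The weight `s ^ (-1/2) * (1 + i s / 2) ^ (-1/2)` of Hankel's integral. -/
noncomputable def hankelWeight (s : ℝ) : ℂ := 1 / (s * rotRoot s⁻¹)

lemma continuousOn_hankelWeight : ContinuousOn hankelWeight (Ioi 0) := by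
  refine continuousOn_const.div (Complex.continuous_ofReal.continuousOn.mul
    (continuous_rotRoot.comp_continuousOn
      (continuousOn_id.inv₀ fun x hx => (ne_of_gt hx)))) fun x hx => ?_
  exact mul_ne_zero (by exact_mod_cast ne_of_gt hx) (rotRoot_ne_zero _)

lemma norm_hankelWeight_le {s : ℝ} (hs : 0 < s) : ‖hankelWeight s‖ ≤ s ^ (-(1 / 2) : ℝ) := by
  have h := sqrt_le_norm_rotRoot s⁻¹
  rw [Real.sqrt_inv] at h
  have hq := Real.sqrt_pos.2 hs
  rw [hankelWeight, norm_div, norm_mul, norm_one, Complex.norm_real, Real.norm_eq_abs,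
    abs_of_pos hs, Real.rpow_neg hs.le, ← Real.sqrt_eq_rpow, ← one_div (√s)]
  refine one_div_le_one_div_of_le hq ?_
  calc √s = s * (√s)⁻¹ := by
        rw [eq_mul_inv_iff_mul_eq₀ hq.ne', Real.mul_self_sqrt hs.le]
    _ ≤ _ := by gcongr

lemma integrableOn_rpow_mul_exp (k : ℕ) {t : ℝ} (ht : 0 < t) :
    IntegrableOn (fun s : ℝ => s ^ ((k : ℝ) - 1 / 2) * Real.exp (-(t * s))) (Ioi 0) := by
  have := integrableOn_rpow_mul_exp_neg_mul_rpow (p := 1) (s := (k : ℝ) - 1 / 2) (b := t)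
    (by linarith [k.cast_nonneg (α := ℝ)]) one_pos ht
  simpa using this

/-- The integrand of `hankelMoment`. -/
noncomputable def hankelIntegrand (k : ℕ) (t s : ℝ) : ℂ :=
  (Real.exp (-(t * s)) : ℂ) * (s : ℂ) ^ k * hankelWeight s

/-- The moments of Hankel's integral. -/
noncomputable def hankelMoment (k : ℕ) (t : ℝ) : ℂ := ∫ s in Ioi (0 : ℝ), hankelIntegrand k t s

lemma norm_hankelIntegrand_le (k : ℕ) (t : ℝ) {s : ℝ} (hs : 0 < s) :
    ‖hankelIntegrand k t s‖ ≤ s ^ ((k : ℝ) - 1 / 2) * Real.exp (-(t * s)) := by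
  rw [hankelIntegrand, norm_mul, norm_mul, norm_pow, Complex.norm_real, Complex.norm_real,
    Real.norm_eq_abs, Real.norm_eq_abs, abs_of_pos hs, abs_of_pos (Real.exp_pos _),
    sub_eq_add_neg, Real.rpow_add hs, Real.rpow_natCast, mul_comm (Real.exp _), mul_right_comm]
  gcongr
  exact norm_hankelWeight_le hs

lemma continuousOn_hankelIntegrand (k : ℕ) (t : ℝ) :
    ContinuousOn (hankelIntegrand k t) (Ioi 0) := by
  refine ContinuousOn.mul (Continuous.continuousOn ?_) continuousOn_hankelWeight
  fun_prop

lemma aestronglyMeasurable_hankelIntegrand (k : ℕ) (t : ℝ) :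
    AEStronglyMeasurable (hankelIntegrand k t) (volume.restrict (Ioi 0)) :=
  (continuousOn_hankelIntegrand k t).aestronglyMeasurable measurableSet_Ioi

lemma integrableOn_hankelIntegrand (k : ℕ) {t : ℝ} (ht : 0 < t) :
    IntegrableOn (hankelIntegrand k t) (Ioi 0) := by
  refine Integrable.mono' (integrableOn_rpow_mul_exp k ht)
    (aestronglyMeasurable_hankelIntegrand k t) ?_
  filter_upwards [ae_restrict_mem measurableSet_Ioi] with s hs
  exact norm_hankelIntegrand_le k t hs

lemma hasDerivAt_hankelMoment (k : ℕ) {t : ℝ} (ht : 0 < t) :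
    HasDerivAt (hankelMoment k) (-hankelMoment (k + 1) t) t := by
  have h := hasDerivAt_integral_of_dominated_loc_of_deriv_le (𝕜 := ℝ)
    (μ := volume.restrict (Ioi (0 : ℝ))) (F := hankelIntegrand k) (x₀ := t)
    (F' := fun t s => -hankelIntegrand (k + 1) t s)
    (bound := fun s => s ^ (((k + 1 : ℕ) : ℝ) - 1 / 2) * Real.exp (-(t / 2 * s)))
    (s := Ioi (t / 2)) (Ioi_mem_nhds (by linarith))
    (Eventually.of_forall fun t => aestronglyMeasurable_hankelIntegrand k t)
    (integrableOn_hankelIntegrand k ht) (aestronglyMeasurable_hankelIntegrand _ t).neg ?_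
    (integrableOn_rpow_mul_exp (k + 1) (by positivity)) ?_
  · have h2 := h.2
    rw [integral_neg] at h2
    exact h2
  · filter_upwards [ae_restrict_mem measurableSet_Ioi] with s hs u hu
    rw [norm_neg]
    refine (norm_hankelIntegrand_le _ u hs).trans ?_
    have hs' : 0 < s := hs
    have hu' : t / 2 < u := hu
    gcongr
  · filter_upwards with s u _
    have h1 : HasDerivAt (fun u : ℝ => ((Real.exp (-(u * s)) : ℝ) : ℂ))
        ((Real.exp (-(u * s)) * -s : ℝ) : ℂ) u :=
      ((((hasDerivAt_id u).mul_const s).neg).exp.congr_deriv (by simp)).ofReal_comp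
    refine ((h1.mul_const ((s : ℂ) ^ k)).mul_const (hankelWeight s)).congr_deriv ?_
    rw [hankelIntegrand]; push_cast; ring

lemma hasDerivAt_rotRoot_inv {s : ℝ} (hs : 0 < s) :
    HasDerivAt (fun s : ℝ => rotRoot s⁻¹) (-(1 / (2 * s ^ 2 * rotRoot s⁻¹))) s := by
  refine ((hasDerivAt_rotRoot s⁻¹).scomp s (hasDerivAt_inv hs.ne')).congr_deriv ?_
  have := rotRoot_ne_zero s⁻¹
  have hs' : (s : ℂ) ≠ 0 := by exact_mod_cast hs.ne'
  simp only [Complex.real_smul]; push_cast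
  field_simp

lemma norm_mul_rotRoot_inv_le {s : ℝ} (hs : 0 < s) :
    ‖(s : ℂ) * rotRoot s⁻¹‖ ≤ √(s + s ^ 2 / 2) := by
  refine Real.le_sqrt_of_sq_le ?_
  rw [norm_mul, mul_pow, Complex.norm_real, Real.norm_eq_abs, sq_abs]
  calc s ^ 2 * ‖rotRoot s⁻¹‖ ^ 2 ≤ s ^ 2 * (s⁻¹ + 1 / 2) := by
        gcongr; exact norm_rotRoot_sq_le (by positivity)
    _ = _ := by field_simp

lemma hankelMoment_relation {t : ℝ} (ht : 0 < t) :
    t * (hankelMoment 2 t - 2 * Complex.I * hankelMoment 1 t) - hankelMoment 1 t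
      + Complex.I * hankelMoment 0 t = 0 := by
  set f : ℝ → ℂ := fun s =>
    2 * Complex.I * ((Real.exp (-(t * s)) : ℂ) * ((s : ℂ) * rotRoot s⁻¹)) with hf
  have hfle : ∀ s, 0 < s → ‖f s‖ ≤ 2 * (Real.exp (-(t * s)) * √(s + s ^ 2 / 2)) := fun s hs => by
    simp only [hf]
    rw [norm_mul, norm_mul, norm_mul (Real.exp (-(t * s)) : ℂ), Complex.norm_I, mul_one,
      Complex.norm_ofNat, Complex.norm_real, Real.norm_eq_abs, abs_of_pos (Real.exp_pos _)]
    gcongr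
    exact norm_mul_rotRoot_inv_le hs
  have hcont : ContinuousWithinAt f (Ici 0) 0 := by
    rw [← continuousWithinAt_Ioi_iff_Ici]
    have h0 : f 0 = 0 := by simp [hf]
    rw [ContinuousWithinAt, h0]
    have hb : Continuous fun s => 2 * (Real.exp (-(t * s)) * √(s + s ^ 2 / 2)) := by fun_prop
    have hb' := (hb.tendsto 0).mono_left (nhdsWithin_le_nhds (s := Ioi 0))
    simp only [ne_eq, OfNat.ofNat_ne_zero, not_false_eq_true, zero_pow, zero_div, add_zero,
      Real.sqrt_zero, mul_zero] at hb'
    refine squeeze_zero_norm' ?_ hb'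
    filter_upwards [self_mem_nhdsWithin] with s hs using hfle s hs
  have htop : Tendsto f atTop (𝓝 0) := by
    have h1 := (tendsto_rpow_mul_exp_neg_mul_atTop_nhds_zero 0 t ht).const_mul 2
    have h2 := (tendsto_rpow_mul_exp_neg_mul_atTop_nhds_zero 1 t ht).const_mul 2
    have h3 := h1.add h2
    simp only [mul_zero, add_zero] at h3
    refine squeeze_zero_norm' ?_ h3
    filter_upwards [eventually_gt_atTop 0] with s hs
    refine (hfle s hs).trans ?_
    have : √(s + s ^ 2 / 2) ≤ 1 + s := by
      rw [Real.sqrt_le_left (by positivity)]; nlinarith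
    rw [Real.rpow_zero, Real.rpow_one, neg_mul]
    calc 2 * (Real.exp (-(t * s)) * √(s + s ^ 2 / 2))
        ≤ 2 * (Real.exp (-(t * s)) * (1 + s)) := by gcongr
      _ = _ := by ring
  have hderiv : ∀ s ∈ Ioi (0 : ℝ), HasDerivAt f
      (t * (hankelIntegrand 2 t s - 2 * Complex.I * hankelIntegrand 1 t s) - hankelIntegrand 1 t s
        + Complex.I * hankelIntegrand 0 t s) s := fun s hs => by
    have hs0 : (0 : ℝ) < s := hs
    have h1 : HasDerivAt (fun s : ℝ => ((Real.exp (-(t * s)) : ℝ) : ℂ))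
        ((Real.exp (-(t * s)) * -t : ℝ) : ℂ) s :=
      ((((hasDerivAt_id s).const_mul t).neg).exp.congr_deriv (by simp)).ofReal_comp
    have h2 : HasDerivAt (fun s : ℝ => (s : ℂ)) 1 s := Complex.ofRealCLM.hasDerivAt
    refine ((h1.mul (h2.mul (hasDerivAt_rotRoot_inv hs0))).const_mul
      (2 * Complex.I)).congr_deriv ?_
    have hr := rotRoot_sq s⁻¹
    have hr0 := rotRoot_ne_zero s⁻¹
    have hs' : (s : ℂ) ≠ 0 := by exact_mod_cast hs0.ne'
    simp only [hankelIntegrand, hankelWeight, Pi.mul_apply]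
    generalize rotRoot s⁻¹ = r at *
    push_cast at hr ⊢
    have hr' : 2 * s * r ^ 2 = 2 + s * Complex.I := by rw [hr]; field_simp
    field_simp
    linear_combination (Complex.I * (1 - s * t)) * hr' + (s - s ^ 2 * t) * Complex.I_sq
  have hint : IntegrableOn (fun s => t * (hankelIntegrand 2 t s -
      2 * Complex.I * hankelIntegrand 1 t s) - hankelIntegrand 1 t s
        + Complex.I * hankelIntegrand 0 t s) (Ioi 0) :=
    ((((integrableOn_hankelIntegrand 2 ht).sub
      ((integrableOn_hankelIntegrand 1 ht).const_mul _)).const_mul _).sub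
      (integrableOn_hankelIntegrand 1 ht)).add ((integrableOn_hankelIntegrand 0 ht).const_mul _)
  have h := integral_Ioi_of_hasDerivAt_of_tendsto hcont hderiv hint htop
  have h0 : f 0 = 0 := by simp [hf]
  rw [h0, sub_zero] at h
  rw [← h, integral_add, integral_sub, integral_const_mul, integral_sub, integral_const_mul,
    integral_const_mul]
  · rfl
  · exact integrableOn_hankelIntegrand 2 ht
  · exact (integrableOn_hankelIntegrand 1 ht).const_mul _
  · exact (((integrableOn_hankelIntegrand 2 ht).sub
      ((integrableOn_hankelIntegrand 1 ht).const_mul _)).const_mul _)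
  · exact integrableOn_hankelIntegrand 1 ht
  · exact ((((integrableOn_hankelIntegrand 2 ht).sub
      ((integrableOn_hankelIntegrand 1 ht).const_mul _)).const_mul _).sub
      (integrableOn_hankelIntegrand 1 ht))
  · exact (integrableOn_hankelIntegrand 0 ht).const_mul _

/-- The bounded part of the primitive of `hankelWeight`, as a function of `s⁻¹`. -/
noncomputable def primTail (y : ℝ) : ℂ := Complex.log (rotRoot 0 + rotRoot y)

/-- The primitive of `hankelWeight` which vanishes at the origin. -/
noncomputable def hankelPrim (s : ℝ) : ℂ :=
  (1 - Complex.I) * (Real.log s + 2 * primTail s⁻¹)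

lemma rotRoot_add_re_pos (y : ℝ) : 0 < (rotRoot 0 + rotRoot y).re :=
  add_pos (rotRoot_re_pos 0) (rotRoot_re_pos y)

lemma rotRoot_add_mem_slitPlane (y : ℝ) : rotRoot 0 + rotRoot y ∈ Complex.slitPlane :=
  Or.inl (rotRoot_add_re_pos y)

lemma continuous_primTail : Continuous primTail :=
  (continuous_const.add continuous_rotRoot).clog rotRoot_add_mem_slitPlane

lemma one_sub_I_mul_rotRoot_zero : (1 - Complex.I) * rotRoot 0 = 1 := by
  rw [rotRoot_zero]; linear_combination -1 / 2 * Complex.I_sq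

lemma hasDerivAt_hankelPrim {s : ℝ} (hs : 0 < s) : HasDerivAt hankelPrim (hankelWeight s) s := by
  have h1 := ((hasDerivAt_rotRoot_inv hs).const_add (rotRoot 0)).clog_real
    (rotRoot_add_mem_slitPlane s⁻¹)
  have h2 := (Real.hasDerivAt_log hs.ne').ofReal_comp
  refine ((h2.add (h1.const_mul 2)).const_mul (1 - Complex.I)).congr_deriv ?_
  have hr := rotRoot_sq s⁻¹
  have h0 := rotRoot_sq 0
  have hb := one_sub_I_mul_rotRoot_zero
  have hne := Complex.slitPlane_ne_zero (rotRoot_add_mem_slitPlane s⁻¹)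
  have hr0 := rotRoot_ne_zero s⁻¹
  have hs' : (s : ℂ) ≠ 0 := by exact_mod_cast hs.ne'
  rw [hankelWeight]
  generalize rotRoot s⁻¹ = r at *
  generalize rotRoot 0 = b at *
  push_cast at hr h0 ⊢
  have hr' : s * (r ^ 2 - b ^ 2) = 1 := by rw [hr, h0]; field_simp; ring
  have e : (1 : ℂ) / (s * r) = (1 - Complex.I) * (b / (s * r)) := by rw [← mul_div_assoc, hb]
  rw [e]
  congr 1
  field_simp
  linear_combination hr'

lemma norm_log_le {z : ℂ} {c M : ℝ} (hc : 0 < c) (hz : c ≤ ‖z‖) (hM : ‖z‖ ≤ M) :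
    ‖Complex.log z‖ ≤ M + 1 / c + Real.pi := by
  have hz0 : 0 < ‖z‖ := hc.trans_le hz
  have h1 : |Real.log ‖z‖| ≤ M + 1 / c := by
    have ha := Real.log_le_sub_one_of_pos hz0
    have hb := Real.log_le_sub_one_of_pos (inv_pos.2 hz0)
    rw [Real.log_inv] at hb
    have hcc : ‖z‖⁻¹ ≤ 1 / c := by rw [one_div]; gcongr
    have : 0 < 1 / c := by positivity
    exact abs_le.2 ⟨by linarith, by linarith⟩
  calc ‖Complex.log z‖ ≤ |(Complex.log z).re| + |(Complex.log z).im| :=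
        Complex.norm_le_abs_re_add_abs_im _
    _ ≤ _ := by
      rw [Complex.log_re, Complex.log_im]
      exact add_le_add h1 (Complex.abs_arg_le_pi z)

lemma norm_primTail_le {y : ℝ} (hy : 0 ≤ y) : ‖primTail y‖ ≤ 8 + √y := by
  have hre : (1 : ℝ) / 2 ≤ ‖rotRoot 0 + rotRoot y‖ := by
    refine le_trans ?_ (Complex.re_le_norm _)
    have h1 := rotRoot_re_pos y
    have h2 : (rotRoot 0).re = 1 / 2 := by rw [rotRoot_zero]; simp
    rw [Complex.add_re]; linarith
  have hb : ∀ y : ℝ, 0 ≤ y → ‖rotRoot y‖ ≤ √y + 1 := fun y hy => by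
    refine abs_le_of_sq_le_sq' ?_ (by positivity) |>.2
    have := norm_rotRoot_sq_le hy
    nlinarith [Real.sq_sqrt hy, Real.sqrt_nonneg y]
  have h0 := hb 0 le_rfl
  have h1 := hb y hy
  rw [Real.sqrt_zero] at h0
  have h := norm_log_le (by norm_num) hre ((norm_add_le _ _).trans (add_le_add h0 h1))
  have := Real.pi_lt_four
  rw [primTail]; linarith

lemma norm_one_sub_I_le : ‖(1 - Complex.I : ℂ)‖ ≤ 2 := by
  refine (norm_sub_le _ _).trans ?_
  simp; norm_num

lemma norm_hankelPrim_le {s : ℝ} (hs : 0 < s) :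
    ‖hankelPrim s‖ ≤ 40 * s ^ ((1 : ℕ) - 1 / 2 : ℝ) + 40 * s ^ ((0 : ℕ) - 1 / 2 : ℝ) := by
  set q := √s with hq
  have hq0 : 0 < q := Real.sqrt_pos.2 hs
  have e1 : s ^ ((1 : ℕ) - 1 / 2 : ℝ) = q := by
    rw [hq, Real.sqrt_eq_rpow]; norm_num
  have e0 : s ^ ((0 : ℕ) - 1 / 2 : ℝ) = q⁻¹ := by
    rw [hq, Real.sqrt_eq_rpow, ← Real.rpow_neg hs.le]; norm_num
  rw [e1, e0]
  have hl : |Real.log s| ≤ 2 * (q + q⁻¹) := by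
    have : Real.log s = 2 * Real.log q := by rw [hq, Real.log_sqrt hs.le]; ring
    rw [this]
    have ha := Real.log_le_sub_one_of_pos hq0
    have hb := Real.log_le_sub_one_of_pos (inv_pos.2 hq0)
    rw [Real.log_inv] at hb
    have := inv_pos.2 hq0
    exact abs_le.2 ⟨by linarith, by linarith⟩
  have ht := norm_primTail_le (inv_pos.2 hs).le
  rw [Real.sqrt_inv, ← hq] at ht
  have h1 : 1 ≤ q + q⁻¹ := by
    rcases le_total 1 q with h | h
    · linarith [inv_pos.2 hq0]
    · linarith [(one_le_inv₀ hq0).2 h]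
  calc ‖hankelPrim s‖ ≤ 2 * (2 * (q + q⁻¹) + 2 * (8 + q⁻¹)) := by
        rw [hankelPrim, norm_mul]
        refine mul_le_mul norm_one_sub_I_le ?_ (norm_nonneg _) (by norm_num)
        refine (norm_add_le _ _).trans (add_le_add ?_ ?_)
        · rwa [Complex.norm_real]
        · rw [norm_mul, Complex.norm_ofNat]; gcongr
    _ ≤ _ := by linarith

lemma hankelPrim_eq {s : ℝ} (hs : 0 < s) : hankelPrim s = (1 - Complex.I) *
    (2 * Complex.log (√s * rotRoot 0 + Complex.exp (Complex.log (1 + s * Complex.I / 2) / 2))) := by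
  have h1 : Complex.log (1 + s * Complex.I / 2) =
      Real.log s + Complex.log ((s⁻¹ : ℝ) + Complex.I / 2) := by
    rw [← Complex.log_ofReal_mul hs (Complex.slitPlane_ne_zero (add_I_half_mem_slitPlane _))]
    congr 1
    have hs' : (s : ℂ) ≠ 0 := by exact_mod_cast hs.ne'
    push_cast; field_simp
  have h2 : Complex.exp (Complex.log (1 + s * Complex.I / 2) / 2) = √s * rotRoot s⁻¹ := by
    rw [h1, add_div, Complex.exp_add, rotRoot]
    congr 1
    rw [← Real.exp_log (Real.sqrt_pos.2 hs), Real.log_sqrt hs.le]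
    push_cast; rfl
  rw [h2, ← mul_add, Complex.log_ofReal_mul (Real.sqrt_pos.2 hs)
    (Complex.slitPlane_ne_zero (rotRoot_add_mem_slitPlane _)), Real.log_sqrt hs.le, hankelPrim,
    primTail]
  push_cast; ring

lemma tendsto_hankelPrim : Tendsto hankelPrim (𝓝[>] 0) (𝓝 0) := by
  have h : ContinuousAt (fun s : ℝ => (1 - Complex.I) * (2 * Complex.log (√s * rotRoot 0 +
      Complex.exp (Complex.log (1 + s * Complex.I / 2) / 2)))) 0 := by
    have h1 : ContinuousAt (fun s : ℝ => Complex.log (1 + s * Complex.I / 2)) 0 :=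
      ContinuousAt.clog (by fun_prop) (by simp)
    have h2 : ContinuousAt (fun s : ℝ => (√s : ℂ) * rotRoot 0 +
        Complex.exp (Complex.log (1 + s * Complex.I / 2) / 2)) 0 :=
      ContinuousAt.add (by fun_prop) (h1.div_const 2).cexp
    exact continuousAt_const.mul (continuousAt_const.mul (h2.clog (by simp)))
  have h' := h.tendsto.mono_left (nhdsWithin_le_nhds (s := Ioi 0))
  simp only [Real.sqrt_zero, Complex.ofReal_zero, zero_mul, zero_div, add_zero, Complex.log_one,
    zero_add, Complex.exp_zero, mul_zero] at h'
  refine h'.congr' ?_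
  filter_upwards [self_mem_nhdsWithin] with s hs using (hankelPrim_eq hs).symm

lemma continuousOn_hankelPrim : ContinuousOn hankelPrim (Ioi 0) := fun _ hs =>
  (hasDerivAt_hankelPrim hs).continuousAt.continuousWithinAt

lemma norm_exp_mul_hankelPrim_le (t : ℝ) {s : ℝ} (hs : 0 < s) :
    ‖(Real.exp (-(t * s)) : ℂ) * hankelPrim s‖ ≤
      40 * (s ^ ((1 : ℕ) - 1 / 2 : ℝ) * Real.exp (-(t * s)))
      + 40 * (s ^ ((0 : ℕ) - 1 / 2 : ℝ) * Real.exp (-(t * s))) := by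
  rw [norm_mul, Complex.norm_real, Real.norm_eq_abs, abs_of_pos (Real.exp_pos _)]
  calc _ ≤ Real.exp (-(t * s)) *
        (40 * s ^ ((1 : ℕ) - 1 / 2 : ℝ) + 40 * s ^ ((0 : ℕ) - 1 / 2 : ℝ)) := by
        gcongr; exact norm_hankelPrim_le hs
    _ = _ := by ring

lemma integrableOn_exp_mul_hankelPrim {t : ℝ} (ht : 0 < t) :
    IntegrableOn (fun s : ℝ => (Real.exp (-(t * s)) : ℂ) * hankelPrim s) (Ioi 0) := by
  refine Integrable.mono' (((integrableOn_rpow_mul_exp 1 ht).const_mul 40).add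
    ((integrableOn_rpow_mul_exp 0 ht).const_mul 40)) ?_ ?_
  · refine ContinuousOn.aestronglyMeasurable ?_ measurableSet_Ioi
    exact ContinuousOn.mul (Continuous.continuousOn (by fun_prop)) continuousOn_hankelPrim
  · filter_upwards [ae_restrict_mem measurableSet_Ioi] with s hs
    exact norm_exp_mul_hankelPrim_le t hs

lemma hankelMoment_zero_eq {t : ℝ} (ht : 0 < t) :
    hankelMoment 0 t = t * ∫ s in Ioi (0 : ℝ), (Real.exp (-(t * s)) : ℂ) * hankelPrim s := by
  have hd : ∀ s : ℝ, HasDerivAt (fun s : ℝ => ((Real.exp (-(t * s)) : ℝ) : ℂ))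
      (-t * (Real.exp (-(t * s)) : ℂ)) s := fun s =>
    ((((hasDerivAt_id s).const_mul t).neg).exp.congr_deriv (by simp; rfl)).ofReal_comp.congr_deriv
      (by push_cast; ring)
  have hint := integrableOn_exp_mul_hankelPrim ht
  have h := integral_Ioi_mul_deriv_eq_deriv_mul (a := (0 : ℝ)) (a' := (0 : ℂ)) (b' := 0)
    (u := fun s : ℝ => ((Real.exp (-(t * s)) : ℝ) : ℂ)) (v := hankelPrim) (v' := hankelWeight)
    (fun s _ => hd s) (fun s hs => hasDerivAt_hankelPrim hs) ?_ ?_ ?_ ?_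
  · rw [hankelMoment]
    simp only [hankelIntegrand, pow_zero, mul_one]
    rw [h, ← integral_const_mul, sub_zero, zero_sub, ← integral_neg]
    refine integral_congr_ae (Eventually.of_forall fun s => ?_)
    simp only; ring
  · refine (integrableOn_hankelIntegrand 0 ht).congr (Eventually.of_forall fun s => ?_)
    simp [hankelIntegrand]
  · refine (hint.const_mul (-(t : ℂ))).congr (Eventually.of_forall fun s => ?_)
    simp only [Pi.mul_apply]; ring
  · have h1 : Continuous fun s : ℝ => ((Real.exp (-(t * s)) : ℝ) : ℂ) := by fun_prop
    have := ((h1.tendsto 0).mono_left (nhdsWithin_le_nhds (s := Ioi 0))).mul tendsto_hankelPrim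
    rwa [mul_zero] at this
  · have h1 := (tendsto_rpow_mul_exp_neg_mul_atTop_nhds_zero ((1 : ℕ) - 1 / 2 : ℝ) t ht).const_mul 40
    have h2 := (tendsto_rpow_mul_exp_neg_mul_atTop_nhds_zero ((0 : ℕ) - 1 / 2 : ℝ) t ht).const_mul 40
    have h3 := h1.add h2
    simp only [mul_zero, add_zero] at h3
    refine squeeze_zero_norm' ?_ h3
    filter_upwards [eventually_gt_atTop 0] with s hs
    simpa only [neg_mul, Pi.mul_apply] using norm_exp_mul_hankelPrim_le t hs

lemma integral_exp_mul_log :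
    ∫ v in Ioi (0 : ℝ), (Real.exp (-v) : ℂ) * (Real.log v : ℂ) =
      -(Real.eulerMascheroniConstant : ℂ) := by
  have h1 := Complex.hasDerivAt_GammaIntegral (s := 1) (by simp)
  have h2 : HasDerivAt Complex.GammaIntegral (-(Real.eulerMascheroniConstant : ℂ)) 1 := by
    refine Complex.hasDerivAt_Gamma_one.congr_of_eventuallyEq ?_
    have : {z : ℂ | 0 < z.re} ∈ 𝓝 (1 : ℂ) :=
      (isOpen_lt continuous_const Complex.continuous_re).mem_nhds (by simp)
    filter_upwards [this] with z hz using (Complex.Gamma_eq_integral hz).symm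
  rw [← h1.unique h2]
  refine integral_congr_ae (Eventually.of_forall fun s => ?_)
  simp [mul_comm]

lemma integral_exp_neg_complex : ∫ v in Ioi (0 : ℝ), (Real.exp (-v) : ℂ) = 1 := by
  rw [integral_complex_ofReal, integral_exp_neg_Ioi_zero]; simp

lemma integrableOn_exp_mul_primTail_bound :
    IntegrableOn (fun v : ℝ => Real.exp (-v) * (8 + (√v)⁻¹)) (Ioi 0) := by
  have h1 : IntegrableOn (fun v : ℝ => Real.exp (-v)) (Ioi 0) := integrableOn_exp_neg_Ioi 0
  have h2 := integrableOn_rpow_mul_exp 0 one_pos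
  refine ((h1.const_mul 8).add h2).congr ?_
  filter_upwards [ae_restrict_mem measurableSet_Ioi] with v hv
  have e0 : v ^ ((0 : ℕ) - 1 / 2 : ℝ) = (√v)⁻¹ := by
    rw [Real.sqrt_eq_rpow, ← Real.rpow_neg (le_of_lt hv)]; norm_num
  simp only [Pi.add_apply, e0, one_mul]; ring

lemma aestronglyMeasurable_exp_mul_primTail (t : ℝ) : AEStronglyMeasurable
    (fun v : ℝ => (Real.exp (-v) : ℂ) * primTail (t * v⁻¹)) (volume.restrict (Ioi 0)) := by
  refine ContinuousOn.aestronglyMeasurable ?_ measurableSet_Ioi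
  refine ContinuousOn.mul (Continuous.continuousOn (by fun_prop))
    (continuous_primTail.comp_continuousOn (continuousOn_const.mul
      (continuousOn_id.inv₀ fun x hx => (ne_of_gt hx))))

lemma norm_exp_mul_primTail_le {t : ℝ} (ht : 0 < t) (ht1 : t < 1) {v : ℝ} (hv : 0 < v) :
    ‖(Real.exp (-v) : ℂ) * primTail (t * v⁻¹)‖ ≤ Real.exp (-v) * (8 + (√v)⁻¹) := by
  rw [norm_mul, Complex.norm_real, Real.norm_eq_abs, abs_of_pos (Real.exp_pos _)]
  gcongr
  refine (norm_primTail_le (by positivity)).trans ?_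
  rw [← Real.sqrt_inv]
  gcongr
  have := inv_pos.2 hv
  nlinarith

lemma tendsto_integral_primTail :
    Tendsto (fun t : ℝ => ∫ v in Ioi (0 : ℝ), (Real.exp (-v) : ℂ) * primTail (t * v⁻¹)) (𝓝[>] 0)
      (𝓝 (primTail 0)) := by
  have h : ∫ v in Ioi (0 : ℝ), (Real.exp (-v) : ℂ) * primTail 0 = primTail 0 := by
    rw [integral_mul_const, integral_exp_neg_complex, one_mul]
  rw [← h]
  refine tendsto_integral_filter_of_dominated_convergence
    (fun v : ℝ => Real.exp (-v) * (8 + (√v)⁻¹))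
    (Eventually.of_forall fun t => aestronglyMeasurable_exp_mul_primTail t) ?_
    integrableOn_exp_mul_primTail_bound ?_
  · filter_upwards [Ioo_mem_nhdsGT one_pos] with t ht
    filter_upwards [ae_restrict_mem measurableSet_Ioi] with v hv
    exact norm_exp_mul_primTail_le ht.1 ht.2 hv
  · refine Eventually.of_forall fun v => ?_
    have hc : Continuous fun t : ℝ => (Real.exp (-v) : ℂ) * primTail (t * v⁻¹) :=
      continuous_const.mul (continuous_primTail.comp (by fun_prop))
    have := (hc.tendsto 0).mono_left (nhdsWithin_le_nhds (s := Ioi 0))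
    simpa using this

lemma hankelMoment_zero_eq_log {t : ℝ} (ht : 0 < t) (ht1 : t < 1) :
    hankelMoment 0 t = (1 - Complex.I) * (-(Real.eulerMascheroniConstant : ℂ) - Real.log t
      + 2 * ∫ v in Ioi (0 : ℝ), (Real.exp (-v) : ℂ) * primTail (t * v⁻¹)) := by
  have hcv := integral_comp_mul_left_Ioi
    (fun v : ℝ => (Real.exp (-v) : ℂ) * hankelPrim (v / t)) 0 ht
  rw [mul_zero] at hcv
  have e : ∀ s : ℝ, t * s / t = s := fun s => by field_simp
  simp only [e] at hcv
  have ht' : (t : ℂ) ≠ 0 := by exact_mod_cast ht.ne'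
  have hi1 : IntegrableOn (fun v : ℝ => (Real.exp (-v) : ℂ) * primTail (t * v⁻¹)) (Ioi 0) := by
    refine Integrable.mono' integrableOn_exp_mul_primTail_bound
      (aestronglyMeasurable_exp_mul_primTail t) ?_
    filter_upwards [ae_restrict_mem measurableSet_Ioi] with v hv
    exact norm_exp_mul_primTail_le ht ht1 hv
  have hi2 : IntegrableOn (fun v : ℝ => (Real.exp (-v) : ℂ)) (Ioi 0) :=
    (integrableOn_exp_neg_Ioi 0).ofReal
  have hi3 : IntegrableOn (fun v : ℝ => (Real.exp (-v) : ℂ) * (Real.log v : ℂ)) (Ioi 0) := by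
    by_contra hn
    have h0 := integral_undef hn
    rw [integral_exp_mul_log] at h0
    have hγ := Real.one_half_lt_eulerMascheroniConstant
    have : Real.eulerMascheroniConstant = 0 := by exact_mod_cast neg_eq_zero.1 h0
    linarith
  rw [hankelMoment_zero_eq ht, hcv, Complex.real_smul, ← mul_assoc, Complex.ofReal_inv,
    mul_inv_cancel₀ ht', one_mul]
  calc _ = ∫ v in Ioi (0 : ℝ), (1 - Complex.I) * ((Real.exp (-v) : ℂ) * (Real.log v : ℂ)
        - (Real.exp (-v) : ℂ) * Real.log t
        + 2 * ((Real.exp (-v) : ℂ) * primTail (t * v⁻¹))) := by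
        refine setIntegral_congr_fun measurableSet_Ioi fun v hv => ?_
        rw [hankelPrim, Real.log_div (ne_of_gt hv) ht.ne', inv_div, div_eq_mul_inv]
        push_cast; ring
    _ = _ := by
        have hi4 : IntegrableOn (fun v : ℝ => (Real.exp (-v) : ℂ) * (Real.log v : ℂ)
            - (Real.exp (-v) : ℂ) * Real.log t) (Ioi 0) := hi3.sub (hi2.mul_const _)
        rw [integral_const_mul, integral_add hi4 (hi1.const_mul 2),
          integral_sub hi3 (hi2.mul_const _), integral_const_mul, integral_mul_const,
          integral_exp_neg_complex, integral_exp_mul_log, one_mul]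

lemma two_mul_primTail_zero : 2 * primTail 0 = Real.log 2 + Complex.I * (Real.pi / 2) := by
  have h : rotRoot 0 + rotRoot 0 = 1 + Complex.I := by rw [rotRoot_zero]; ring
  have hn : (1 + Complex.I : ℂ) = (√2 : ℝ) * Complex.exp ((Real.pi / 4 : ℝ) * Complex.I) := by
    rw [Complex.exp_mul_I, ← Complex.ofReal_cos, ← Complex.ofReal_sin, Real.cos_pi_div_four,
      Real.sin_pi_div_four]
    have : ((√2 : ℝ) : ℂ) * (√2 : ℝ) = 2 := by
      rw [← Complex.ofReal_mul, Real.mul_self_sqrt (by norm_num)]; norm_num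
    push_cast
    linear_combination -(1 + Complex.I) / 2 * this
  have hpi := Real.pi_pos
  rw [primTail, h, hn, Complex.log_ofReal_mul (Real.sqrt_pos.2 two_pos) (Complex.exp_ne_zero _),
    Complex.log_exp (by simp; linarith) (by simp; linarith), Real.log_sqrt (by norm_num)]
  push_cast; ring

/-- Hankel's integral representation of `H₀⁽¹⁾`. -/
noncomputable def hankelRep (t : ℝ) : ℂ :=
  (1 - Complex.I) / Real.pi * (Complex.exp (Complex.I * t) * hankelMoment 0 t)

/-- The Euler derivative of `hankelRep`. -/
noncomputable def hankelRepEuler (t : ℝ) : ℂ :=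
  (1 - Complex.I) / Real.pi *
    (Complex.exp (Complex.I * t) * (t * (Complex.I * hankelMoment 0 t - hankelMoment 1 t)))

lemma hasDerivAt_exp_I_mul (t : ℝ) : HasDerivAt (fun t : ℝ => Complex.exp (Complex.I * t))
    (Complex.I * Complex.exp (Complex.I * t)) t := by
  have h : HasDerivAt (fun t : ℝ => (t : ℂ)) 1 t := Complex.ofRealCLM.hasDerivAt
  exact (h.const_mul Complex.I).cexp.congr_deriv (by ring)

lemma hasDerivAt_hankelRep {t : ℝ} (ht : 0 < t) :
    HasDerivAt hankelRep (hankelRepEuler t / t) t := by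
  refine (((hasDerivAt_exp_I_mul t).mul (hasDerivAt_hankelMoment 0 ht)).const_mul
    ((1 - Complex.I) / Real.pi)).congr_deriv ?_
  have ht' : (t : ℂ) ≠ 0 := by exact_mod_cast ht.ne'
  rw [hankelRepEuler, zero_add]
  field_simp
  ring

lemma hasDerivAt_hankelRepEuler {t : ℝ} (ht : 0 < t) :
    HasDerivAt hankelRepEuler (-(t * hankelRep t)) t := by
  have h : HasDerivAt (fun t : ℝ => (t : ℂ)) 1 t := Complex.ofRealCLM.hasDerivAt
  refine (((hasDerivAt_exp_I_mul t).mul (h.mul (((hasDerivAt_hankelMoment 0 ht).const_mul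
    Complex.I).sub (hasDerivAt_hankelMoment 1 ht)))).const_mul
    ((1 - Complex.I) / Real.pi)).congr_deriv ?_
  have hrel := hankelMoment_relation ht
  simp only [hankelRep, Pi.mul_apply, Pi.sub_apply, zero_add, one_add_one_eq_two]
  linear_combination (1 - Complex.I) / Real.pi * Complex.exp (Complex.I * t) * hrel +
    (1 - Complex.I) / Real.pi * Complex.exp (Complex.I * t) * t * hankelMoment 0 t * Complex.I_sq

/-- The logarithmic term of `Y₀`. -/
noncomputable def logTerm (t : ℝ) : ℝ := Real.log (t / 2) + Real.eulerMascheroniConstant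

lemma tendsto_mul_logTerm : Tendsto (fun t => t * logTerm t) (𝓝[>] 0) (𝓝 0) := by
  have h1 := tendsto_log_mul_rpow_nhdsGT_zero one_pos
  have h2 : Tendsto (fun t : ℝ => t * (Real.eulerMascheroniConstant - Real.log 2)) (𝓝[>] 0)
      (𝓝 (0 * (Real.eulerMascheroniConstant - Real.log 2))) :=
    (tendsto_id.mono_left nhdsWithin_le_nhds).mul_const _
  have h3 := h1.add h2
  rw [zero_mul, add_zero] at h3
  refine h3.congr' ?_
  filter_upwards [self_mem_nhdsWithin] with t ht
  rw [logTerm, Real.log_div (ne_of_gt ht) two_ne_zero, Real.rpow_one]; ring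

lemma tendsto_hankelMoment_sub : Tendsto (fun t : ℝ => (1 - Complex.I) / Real.pi * hankelMoment 0 t
    - (1 + Complex.I * (2 / Real.pi * logTerm t : ℝ))) (𝓝[>] 0) (𝓝 0) := by
  have h := ((tendsto_integral_primTail.sub_const (primTail 0)).const_mul
    (-(4 * Complex.I / Real.pi)))
  rw [sub_self, mul_zero] at h
  refine h.congr' ?_
  filter_upwards [Ioo_mem_nhdsGT one_pos] with t ht
  have hpi : (Real.pi : ℂ) ≠ 0 := by exact_mod_cast Real.pi_pos.ne'
  rw [hankelMoment_zero_eq_log ht.1 ht.2, logTerm, Real.log_div ht.1.ne' two_ne_zero]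
  have h2 := two_mul_primTail_zero
  generalize ∫ v in Ioi (0 : ℝ), (Real.exp (-v) : ℂ) * primTail (t * v⁻¹) = T
  have hp : primTail 0 = (Real.log 2 + Complex.I * (Real.pi / 2)) / 2 := by rw [← h2]; ring
  rw [hp]
  push_cast
  field_simp
  have hI := Complex.I_sq
  ring_nf
  simp only [hI]
  ring

lemma tendsto_hankelRep_sub : Tendsto (fun t : ℝ => hankelRep t
    - (1 + Complex.I * (2 / Real.pi * logTerm t : ℝ))) (𝓝[>] 0) (𝓝 0) := by
  have hid : Tendsto (fun t : ℝ => t) (𝓝[>] 0) (𝓝 0) := tendsto_id.mono_left nhdsWithin_le_nhds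
  have h1 := tendsto_hankelMoment_sub
  have hbound : Tendsto (fun t : ℝ => t + 2 / Real.pi * |t * logTerm t|) (𝓝[>] 0) (𝓝 0) := by
    have := hid.add (tendsto_mul_logTerm.abs.const_mul (2 / Real.pi))
    simpa using this
  have h2 : Tendsto (fun t : ℝ => (Complex.exp (Complex.I * t) - 1) *
      (1 + Complex.I * (2 / Real.pi * logTerm t : ℝ))) (𝓝[>] 0) (𝓝 0) := by
    refine squeeze_zero_norm' ?_ hbound
    filter_upwards [self_mem_nhdsWithin] with t ht
    have ht' : 0 < t := ht
    have hp := Real.pi_pos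
    rw [norm_mul]
    calc _ ≤ ‖t‖ * (1 + 2 / Real.pi * |logTerm t|) := by
          refine mul_le_mul Real.norm_exp_I_mul_ofReal_sub_one_le ((norm_add_le _ _).trans ?_)
            (norm_nonneg _) (norm_nonneg _)
          rw [norm_mul, Complex.norm_I, norm_one, one_mul, Complex.norm_real, Real.norm_eq_abs,
            abs_mul, abs_of_pos (by positivity : 0 < 2 / Real.pi)]
      _ = _ := by rw [Real.norm_eq_abs, abs_mul, abs_of_pos ht']; ring
  have h3 : Tendsto (fun t : ℝ => Complex.exp (Complex.I * t)) (𝓝[>] 0) (𝓝 1) := by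
    have := ((hasDerivAt_exp_I_mul 0).continuousAt.tendsto).mono_left
      (nhdsWithin_le_nhds (s := Ioi 0))
    simpa using this
  have h4 := (h3.mul h1).add h2
  rw [mul_zero, add_zero] at h4
  refine h4.congr fun t => ?_
  rw [hankelRep]; ring

lemma tendsto_hankelH0_sub : Tendsto (fun t : ℝ => hankelH0 t
    - (1 + Complex.I * (2 / Real.pi * logTerm t : ℝ))) (𝓝[>] 0) (𝓝 0) := by
  have hid : Tendsto (fun t : ℝ => t) (𝓝[>] 0) (𝓝 0) := tendsto_id.mono_left nhdsWithin_le_nhds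
  have hJ : ∀ᶠ t in 𝓝[>] (0 : ℝ), |besselJ0 t - 1| ≤ t ∧ |seriesY t| ≤ t := by
    filter_upwards [Ioo_mem_nhdsGT one_pos] with t ht
    have h4 : t ^ 2 / 4 ≤ t := by nlinarith [ht.1, ht.2]
    have h1 := besselJ0_mem_Icc (h4.trans ht.2.le)
    have h2 := seriesY_mem_Icc (h4.trans ht.2.le)
    exact ⟨abs_le.2 ⟨by linarith [h1.1], by linarith [h1.2, ht.1]⟩,
      abs_le.2 ⟨by linarith [h2.1], by linarith [h2.2, ht.1]⟩⟩
  have hJ1 : Tendsto (fun t => besselJ0 t - 1) (𝓝[>] 0) (𝓝 0) :=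
    squeeze_zero_norm' (hJ.mono fun t ht => ht.1) hid
  have hS : Tendsto seriesY (𝓝[>] 0) (𝓝 0) :=
    squeeze_zero_norm' (hJ.mono fun t ht => ht.2) hid
  have hL : Tendsto (fun t => logTerm t * (besselJ0 t - 1)) (𝓝[>] 0) (𝓝 0) := by
    have h0 := tendsto_mul_logTerm.abs
    rw [abs_zero] at h0
    refine squeeze_zero_norm' ?_ h0
    filter_upwards [hJ, self_mem_nhdsWithin] with t ht ht0
    have ht0' : 0 < t := ht0
    rw [Real.norm_eq_abs, abs_mul, abs_mul, abs_of_pos ht0', mul_comm]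
    gcongr
    exact ht.1
  have hY := (hL.sub hS).const_mul (2 / Real.pi)
  rw [sub_zero, mul_zero] at hY
  have h := ((Complex.continuous_ofReal.tendsto 0).comp hJ1).add
    (((Complex.continuous_ofReal.tendsto 0).comp hY).const_mul Complex.I)
  simp only [Complex.ofReal_zero, mul_zero, add_zero] at h
  refine h.congr fun t => ?_
  simp only [Function.comp_apply]
  rw [hankelH0, besselY0_eq, logTerm]
  push_cast; ring

/-- Hankel's integral representation. -/
lemma hankelH0_eq_hankelRep {t : ℝ} (ht : 0 < t) : hankelH0 t = hankelRep t := by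
  have hlim : Tendsto (fun t => hankelRep t - hankelH0 t) (𝓝[>] 0) (𝓝 0) := by
    have := tendsto_hankelRep_sub.sub tendsto_hankelH0_sub
    rw [sub_zero] at this
    exact this.congr fun t => by ring
  have hre : ∀ t, (hankelRep t - hankelH0 t).re = (hankelRep t).re - besselJ0 t := fun t => by
    simp [hankelH0]
  have him : ∀ t, (hankelRep t - hankelH0 t).im = (hankelRep t).im - besselY0 t := fun t => by
    simp [hankelH0]
  have h1 : (hankelRep t).re - besselJ0 t = 0 := by
    refine eq_zero_of_bessel_of_tendsto (D := fun t => (hankelRep t).re - besselJ0 t)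
      (E := fun t => (hankelRepEuler t).re - eulerJ t) (fun t ht => ?_) (fun t ht => ?_) ?_ ht
    · refine ((Complex.reCLM.hasFDerivAt.comp_hasDerivAt t (hasDerivAt_hankelRep ht)).sub
        (hasDerivAt_besselJ0 ht)).congr_deriv ?_
      rw [Complex.reCLM_apply, Complex.div_ofReal_re]; ring
    · refine ((Complex.reCLM.hasFDerivAt.comp_hasDerivAt t (hasDerivAt_hankelRepEuler ht)).sub
        (hasDerivAt_eulerJ t)).congr_deriv ?_
      rw [Complex.reCLM_apply, Complex.neg_re, Complex.re_ofReal_mul]; ring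
    · have := (Complex.continuous_re.tendsto 0).comp hlim
      exact this.congr hre
  have h2 : (hankelRep t).im - besselY0 t = 0 := by
    refine eq_zero_of_bessel_of_tendsto (D := fun t => (hankelRep t).im - besselY0 t)
      (E := fun t => (hankelRepEuler t).im - eulerY t) (fun t ht => ?_) (fun t ht => ?_) ?_ ht
    · refine ((Complex.imCLM.hasFDerivAt.comp_hasDerivAt t (hasDerivAt_hankelRep ht)).sub
        (hasDerivAt_besselY0 ht)).congr_deriv ?_
      rw [Complex.imCLM_apply, Complex.div_ofReal_im]; ring
    · refine ((Complex.imCLM.hasFDerivAt.comp_hasDerivAt t (hasDerivAt_hankelRepEuler ht)).sub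
        (hasDerivAt_eulerY ht)).congr_deriv ?_
      rw [Complex.imCLM_apply, Complex.neg_im, Complex.im_ofReal_mul]; ring
    · have := (Complex.continuous_im.tendsto 0).comp hlim
      exact this.congr him
  refine (sub_eq_zero.1 (Complex.ext ?_ ?_)).symm
  · rw [hre, h1, Complex.zero_re]
  · rw [him, h2, Complex.zero_im]

lemma norm_hankelMoment_zero_le {t : ℝ} (ht : 0 < t) : ‖hankelMoment 0 t‖ ≤ √(Real.pi / t) := by
  have h := Real.integral_rpow_mul_exp_neg_mul_Ioi (a := 1 / 2) (by norm_num) ht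
  have e : (1 / t) ^ (1 / 2 : ℝ) * Real.Gamma (1 / 2) = √(Real.pi / t) := by
    rw [Real.Gamma_one_half_eq, ← Real.sqrt_eq_rpow, ← Real.sqrt_mul (by positivity)]
    congr 1; ring
  rw [← e, ← h]
  refine norm_integral_le_of_norm_le ?_ ?_
  · refine (integrableOn_rpow_mul_exp 0 ht).congr (Eventually.of_forall fun s => ?_)
    norm_num
  · filter_upwards [ae_restrict_mem measurableSet_Ioi] with s hs
    refine (norm_hankelIntegrand_le 0 t hs).trans_eq ?_
    norm_num

lemma norm_one_sub_I : ‖(1 - Complex.I : ℂ)‖ = √2 := by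
  rw [Complex.norm_def, Complex.normSq_apply]; norm_num

/-- `|H₀⁽¹⁾(t)| ≤ √(2 / (π t))`. -/
lemma norm_hankelH0_le_sqrt {t : ℝ} (ht : 0 < t) : ‖hankelH0 t‖ ≤ √(2 / (Real.pi * t)) := by
  have hp := Real.pi_pos
  rw [hankelH0_eq_hankelRep ht, hankelRep, norm_mul, norm_div, norm_one_sub_I, norm_mul,
    mul_comm Complex.I, Complex.norm_exp_ofReal_mul_I, one_mul, Complex.norm_real,
    Real.norm_eq_abs, abs_of_pos hp]
  calc √2 / Real.pi * ‖hankelMoment 0 t‖ ≤ √2 / Real.pi * √(Real.pi / t) := by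
        gcongr; exact norm_hankelMoment_zero_le ht
    _ = √(2 / (Real.pi * t)) := by
        rw [div_mul_eq_mul_div, ← Real.sqrt_mul (by norm_num), div_eq_iff hp.ne']
        nth_rewrite 3 [← Real.sqrt_sq hp.le]
        rw [← Real.sqrt_mul (by positivity)]
        congr 1; field_simp

lemma logTerm_le_of_le {t : ℝ} (ht : 0 < t) (h : t ≤ 2 / Real.pi) : logTerm t ≤ -(1 / 3) := by
  have hp := Real.pi_pos
  have h1 : Real.log (t / 2) ≤ Real.log (Real.exp 1)⁻¹ := by
    refine Real.log_le_log (by positivity) ?_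
    have he := Real.exp_one_lt_d9
    have hp3 := Real.pi_gt_three
    calc t / 2 ≤ Real.pi⁻¹ := by rw [← one_div]; linarith [h, (by ring : 2 / Real.pi = 2 * (1 / Real.pi))]
      _ ≤ (Real.exp 1)⁻¹ := by gcongr; linarith
  rw [Real.log_inv, Real.log_exp] at h1
  have := Real.eulerMascheroniConstant_lt_two_thirds
  rw [logTerm]; linarith

/-- `|H₀⁽¹⁾(t)|² ≤ 1 + (4 / π²) (γ + log (t / 2))²`. -/
lemma norm_hankelH0_le_log {t : ℝ} (ht : 0 < t) :
    ‖hankelH0 t‖ ≤ √(1 + 4 / Real.pi ^ 2 *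
      (Real.eulerMascheroniConstant + Real.log (t / 2)) ^ 2) := by
  have hp := Real.pi_pos
  rcases le_total t (2 / Real.pi) with h | h
  · have hL := logTerm_le_of_le ht h
    have ht1 : t ≤ 2 / 3 := h.trans (by gcongr; exact Real.pi_gt_three.le)
    have hx : t ^ 2 / 4 ≤ 1 / 9 := by nlinarith
    have hJ := besselJ0_mem_Icc (hx.trans (by norm_num))
    have hS := seriesY_mem_Icc (hx.trans (by norm_num))
    have hY : besselY0 t = 2 / Real.pi * (logTerm t * besselJ0 t - seriesY t) := besselY0_eq t
    have hJ0 : 0 ≤ besselJ0 t := by linarith [hJ.1]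
    have hsq : (logTerm t * besselJ0 t - seriesY t) ^ 2 ≤ logTerm t ^ 2 := by
      refine sq_le_sq' ?_ ?_ |>.trans_eq (neg_sq _)
      · nlinarith [hJ.2, hS.2]
      · nlinarith [hS.1]
    rw [add_comm (Real.eulerMascheroniConstant), ← logTerm]
    refine Real.le_sqrt_of_sq_le ?_
    have hn : ‖hankelH0 t‖ ^ 2 = besselJ0 t ^ 2 + besselY0 t ^ 2 := by
      rw [Complex.sq_norm, Complex.normSq_apply]; simp [hankelH0]; ring
    rw [hn, hY, mul_pow, div_pow]
    have hJ2 : besselJ0 t ^ 2 ≤ 1 := by nlinarith [hJ.2]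
    have h4 : (2 : ℝ) ^ 2 / Real.pi ^ 2 = 4 / Real.pi ^ 2 := by norm_num
    rw [h4]
    gcongr
  · refine (norm_hankelH0_le_sqrt ht).trans (Real.sqrt_le_sqrt ?_)
    have h1 : 2 / (Real.pi * t) ≤ 1 := by
      rw [div_le_one (by positivity)]
      rw [div_le_iff₀ hp] at h; linarith
    have : 0 ≤ 4 / Real.pi ^ 2 * (Real.eulerMascheroniConstant + Real.log (t / 2)) ^ 2 := by
      positivity
    linarith

lemma sqrt_two_div_antitone {τ₁ τ₂ : ℝ} (h1 : 0 < τ₁) (h : τ₁ ≤ τ₂) :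
    √(2 / (Real.pi * τ₂)) ≤ √(2 / (Real.pi * τ₁)) := by
  have hp := Real.pi_pos
  gcongr

lemma sqrt_two_div_le_one {τ : ℝ} (h0 : 0 < τ) (h : 2 / Real.pi ≤ τ) :
    √(2 / (Real.pi * τ)) ≤ 1 := by
  have hp := Real.pi_pos
  refine Real.sqrt_le_one.2 ((div_le_one (by positivity)).2 ?_)
  rw [div_le_iff₀ hp] at h; linarith

lemma one_le_sqrt_logTerm (τ : ℝ) : 1 ≤ √(1 + 4 / Real.pi ^ 2 * logTerm τ ^ 2) := by
  rw [Real.one_le_sqrt]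
  have : 0 ≤ 4 / Real.pi ^ 2 * logTerm τ ^ 2 := by positivity
  linarith

lemma min_sqrt_antitone {τ₁ τ₂ : ℝ} (h1 : 0 < τ₁) (h : τ₁ ≤ τ₂) :
    min √(1 + 4 / Real.pi ^ 2 * logTerm τ₂ ^ 2) √(2 / (Real.pi * τ₂)) ≤
      min √(1 + 4 / Real.pi ^ 2 * logTerm τ₁ ^ 2) √(2 / (Real.pi * τ₁)) := by
  refine le_min ?_ ((min_le_right _ _).trans (sqrt_two_div_antitone h1 h))
  rcases le_total τ₂ (2 / Real.pi) with h2 | h2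
  · refine (min_le_left _ _).trans (Real.sqrt_le_sqrt ?_)
    have hL := logTerm_le_of_le (h1.trans_le h) h2
    have hm : logTerm τ₁ ≤ logTerm τ₂ := by
      rw [logTerm, logTerm]; gcongr
    have : logTerm τ₂ ^ 2 ≤ logTerm τ₁ ^ 2 := by nlinarith
    gcongr
  · exact (min_le_right _ _).trans
      ((sqrt_two_div_le_one (h1.trans_le h) h2).trans (one_le_sqrt_logTerm τ₁))

lemma phi_two (κ t : ℝ) : phi 2 κ t =
    1 / 4 * min √(1 + 4 / Real.pi ^ 2 * logTerm (κ * t) ^ 2) √(2 / (Real.pi * (κ * t))) := by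
  rw [phi, if_pos rfl, logTerm, add_comm (Real.log _), mul_assoc Real.pi]

lemma phi_of_ne_two {d : ℕ} (hd : d ≠ 2) (κ t : ℝ) : phi d κ t = 1 / (4 * Real.pi * t) := if_neg hd

lemma phi_antitone (d : ℕ) {κ t₁ t₂ : ℝ} (hκ : 0 < κ) (h1 : 0 < t₁) (h : t₁ ≤ t₂) :
    phi d κ t₂ ≤ phi d κ t₁ := by
  by_cases hd : d = 2
  · subst hd
    rw [phi_two, phi_two]
    have := min_sqrt_antitone (mul_pos hκ h1) (mul_le_mul_of_nonneg_left h hκ.le)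
    linarith
  · rw [phi_of_ne_two hd, phi_of_ne_two hd]
    have hp := Real.pi_pos
    gcongr

lemma phi_nonneg (d : ℕ) (κ : ℝ) {t : ℝ} (ht : 0 ≤ t) : 0 ≤ phi d κ t := by
  by_cases hd : d = 2
  · subst hd
    rw [phi_two]; positivity
  · rw [phi_of_ne_two hd]
    have hp := Real.pi_pos
    positivity

lemma norm_exp_I_mul (κ r : ℝ) : ‖Complex.exp (Complex.I * (κ : ℂ) * (r : ℂ))‖ = 1 := by
  rw [show Complex.I * (κ : ℂ) * (r : ℂ) = ((κ * r : ℝ) : ℂ) * Complex.I by push_cast; ring]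
  exact Complex.norm_exp_ofReal_mul_I _

lemma norm_exp_neg_I_mul (κ r : ℝ) : ‖Complex.exp (-(Complex.I * (κ : ℂ) * (r : ℂ)))‖ = 1 := by
  rw [Complex.exp_neg, norm_inv, norm_exp_I_mul, inv_one]

lemma norm_green_le {d : ℕ} {κ : ℝ} (hκ : 0 < κ) {x y : EuclideanSpace ℝ (Fin d)} (hxy : x ≠ y) :
    ‖green κ x y‖ ≤ phi d κ ‖x - y‖ := by
  have hr : 0 < ‖x - y‖ := norm_pos_iff.2 (sub_ne_zero.2 hxy)
  by_cases hd : d = 2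
  · subst hd
    have hτ := mul_pos hκ hr
    have h1 := norm_hankelH0_le_log hτ
    rw [add_comm Real.eulerMascheroniConstant, ← logTerm] at h1
    have h := le_min h1 (norm_hankelH0_le_sqrt hτ)
    rw [phi_two, green, if_pos rfl, norm_mul, norm_div, Complex.norm_I, Complex.norm_ofNat]
    gcongr
  · rw [phi_of_ne_two hd, green, if_neg hd, norm_mul, norm_exp_I_mul, mul_one]
    refine le_of_eq ?_
    simp [abs_of_pos Real.pi_pos]

section System

variable {s : ℕ} {M : Fin s → Fin s → ℂ} {α : ℝ}

lemma norm_row_sum_le (hM : ∀ i, ∑ j, ‖M i j‖ ≤ α) {v : Fin s → ℂ} {B : ℝ} (hB : 0 ≤ B)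
    (hv : ∀ j, ‖v j‖ ≤ B) (i : Fin s) : ‖∑ j, M i j * v j‖ ≤ α * B := by
  calc ‖∑ j, M i j * v j‖ ≤ ∑ j, ‖M i j‖ * B :=
        norm_sum_le_of_le _ fun j _ => by rw [norm_mul]; gcongr; exact hv j
    _ = (∑ j, ‖M i j‖) * B := (Finset.sum_mul _ _ _).symm
    _ ≤ α * B := by gcongr; exact hM i

lemma norm_le_of_system (hM : ∀ i, ∑ j, ‖M i j‖ ≤ α) (h0 : 0 ≤ α) (h1 : α < 1)
    {u f : Fin s → ℂ} {F : ℝ} (hF : 0 ≤ F) (hf : ∀ i, ‖f i‖ ≤ F)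
    (hu : ∀ i, u i = f i + ∑ j, M i j * u j) : ‖u‖ ≤ F / (1 - α) := by
  have h : ‖u‖ ≤ F + α * ‖u‖ := by
    refine (pi_norm_le_iff_of_nonneg (by positivity)).2 fun i => ?_
    rw [hu i]
    refine (norm_add_le _ _).trans (add_le_add (hf i) ?_)
    exact norm_row_sum_le hM (norm_nonneg u) (fun j => norm_le_pi_norm u j) i
  rw [le_div_iff₀ (by linarith)]
  linarith

lemma existsUnique_system (hM : ∀ i, ∑ j, ‖M i j‖ ≤ α) (h0 : 0 ≤ α) (h1 : α < 1)
    (f : Fin s → ℂ) : ∃! u : Fin s → ℂ, ∀ i, u i = f i + ∑ j, M i j * u j := by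
  set L : (Fin s → ℂ) →ₗ[ℂ] (Fin s → ℂ) := LinearMap.id - Matrix.mulVecLin (Matrix.of M)
  have hL : ∀ u i, L u i = u i - ∑ j, M i j * u j := fun u i => by
    simp [L, Matrix.mulVec, dotProduct]
  have hinj : Function.Injective L := by
    refine (injective_iff_map_eq_zero L).2 fun v hv => ?_
    have h := norm_le_of_system hM h0 h1 (u := v) (f := 0) le_rfl (by simp) fun i => by
      have := congrFun hv i
      rw [hL] at this
      simpa using sub_eq_zero.1 this
    rw [zero_div] at h
    exact norm_le_zero_iff.1 h
  obtain ⟨u, hu⟩ := LinearMap.injective_iff_surjective.1 hinj f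
  refine ⟨u, fun i => ?_, fun v hv => hinj ?_⟩
  · rw [← hu, hL]; ring
  · rw [hu]; funext i; rw [hL]; linear_combination hv i

lemma norm_sub_le_of_system (hM : ∀ i, ∑ j, ‖M i j‖ ≤ α) (h0 : 0 ≤ α) (h1 : α < 1)
    {u f : Fin s → ℂ} (hf : ∀ i, ‖f i‖ ≤ 1) (hu : ∀ i, u i = f i + ∑ j, M i j * u j)
    (i : Fin s) : ‖u i - f i‖ ≤ α / (1 - α) := by
  have h := norm_le_of_system hM h0 h1 zero_le_one hf hu
  have hp : 0 ≤ 1 / (1 - α) := one_div_nonneg.2 (by linarith)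
  have hi : u i - f i = ∑ j, M i j * u j := by linear_combination hu i
  rw [hi, ← mul_one_div]
  exact norm_row_sum_le hM hp (fun j => (norm_le_pi_norm u j).trans h) i

lemma norm_sub_le_sq_add_of_system (hM : ∀ i, ∑ j, ‖M i j‖ ≤ α) (h0 : 0 ≤ α) (h1 : α < 1)
    {u f : Fin s → ℂ} (hf : ∀ i, ‖f i‖ ≤ 1) (hu : ∀ i, u i = f i + ∑ j, M i j * u j)
    (i : Fin s) : ‖u i - f i‖ ≤ α ^ 2 / (1 - α) + ∑ j, ‖M i j‖ := by
  have hi : u i - f i = ∑ j, M i j * (u j - f j) + ∑ j, M i j * f j := by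
    rw [← Finset.sum_add_distrib]
    calc u i - f i = ∑ j, M i j * u j := by linear_combination hu i
      _ = _ := Finset.sum_congr rfl fun j _ => by ring
  have hp : 0 ≤ α / (1 - α) := div_nonneg h0 (by linarith)
  rw [hi]
  refine (norm_add_le _ _).trans (add_le_add ?_ ?_)
  · refine (norm_row_sum_le hM hp (norm_sub_le_of_system hM h0 h1 hf hu) i).trans_eq ?_
    ring
  · refine norm_sum_le_of_le _ fun j _ => ?_
    rw [norm_mul]
    exact mul_le_of_le_one_right (norm_nonneg _) (hf j)

end System

section Scatterers

variable {d s : ℕ} {κ : ℝ} {a : Fin s → ℂ} {x : Fin s → EuclideanSpace ℝ (Fin d)}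

/-- The matrix of the Foldy-Lax system. -/
noncomputable def foldyMatrix (κ : ℝ) (a : Fin s → ℂ) (x : Fin s → EuclideanSpace ℝ (Fin d))
    (i j : Fin s) : ℂ :=
  if j = i then 0 else (κ : ℂ) ^ 2 * (green κ (x i) (x j) * a j)

lemma sum_ite_eq_sum_erase {E : Type*} [AddCommMonoid E] (g : Fin s → E) (i : Fin s) :
    ∑ j, (if j = i then 0 else g j) = ∑ j ∈ Finset.univ.erase i, g j := by
  rw [← Finset.sum_erase (a := i) _ (by simp)]
  exact Finset.sum_congr rfl fun j hj => if_neg (Finset.ne_of_mem_erase hj)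

lemma isFoldySolution_iff (θ : Direction d) (u : Fin s → ℂ) : IsFoldySolution κ a x θ u ↔
    ∀ i, u i = incident κ θ (x i) + ∑ j, foldyMatrix κ a x i j * u j := by
  refine forall_congr' fun i => ?_
  simp only [foldyMatrix, ite_mul, zero_mul]
  rw [sum_ite_eq_sum_erase, Finset.mul_sum]
  simp only [mul_assoc]

lemma norm_incident (θ : Direction d) (y : EuclideanSpace ℝ (Fin d)) : ‖incident κ θ y‖ = 1 :=
  norm_exp_I_mul _ _

lemma separation_nonneg : 0 ≤ separation x := Real.iInf_nonneg fun _ => norm_nonneg _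

lemma separation_le {i j : Fin s} (hij : i ≠ j) : separation x ≤ ‖x i - x j‖ :=
  ciInf_le (Set.finite_range _).bddBelow (⟨(i, j), hij⟩ : {p : Fin s × Fin s // p.1 ≠ p.2})

lemma separation_pos (hx : Function.Injective x) {i j : Fin s} (hij : i ≠ j) :
    0 < separation x := by
  have : Nonempty {p : Fin s × Fin s // p.1 ≠ p.2} := ⟨⟨(i, j), hij⟩⟩
  obtain ⟨p, hp⟩ := exists_eq_ciInf_of_finite
    (f := fun p : {p : Fin s × Fin s // p.1 ≠ p.2} => ‖x p.1.1 - x p.1.2‖)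
  rw [separation, ← hp]
  exact norm_pos_iff.2 (sub_ne_zero.2 (hx.ne p.2))

lemma phi_norm_sub_le (hκ : 0 < κ) (hx : Function.Injective x) {i j : Fin s} (hij : i ≠ j) :
    phi d κ ‖x i - x j‖ ≤ phi d κ (separation x) :=
  phi_antitone d hκ (separation_pos hx hij) (separation_le hij)

lemma sum_erase_le_maxRemovedL1 (a : Fin s → ℂ) (i : Fin s) :
    ∑ j ∈ Finset.univ.erase i, ‖a j‖ ≤ maxRemovedL1 a :=
  le_ciSup (f := fun i => ∑ j ∈ Finset.univ.erase i, ‖a j‖) (Set.finite_range _).bddAbove i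

lemma alpha_nonneg : 0 ≤ alpha κ a x := by
  have h1 := phi_nonneg d κ (separation_nonneg (x := x))
  have h2 : 0 ≤ maxRemovedL1 a :=
    Real.iSup_nonneg fun i => Finset.sum_nonneg fun j _ => norm_nonneg _
  rw [alpha]; positivity

lemma sum_norm_foldyMatrix_le (hκ : 0 < κ) (hx : Function.Injective x) (i : Fin s) :
    ∑ j, ‖foldyMatrix κ a x i j‖ ≤
      ∑ j ∈ Finset.univ.erase i, κ ^ 2 * phi d κ ‖x i - x j‖ * ‖a j‖ := by
  rw [← sum_ite_eq_sum_erase]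
  refine Finset.sum_le_sum fun j _ => ?_
  rw [foldyMatrix]
  split_ifs with h
  · simp
  · rw [norm_mul, norm_mul, norm_pow, Complex.norm_real, Real.norm_eq_abs, sq_abs, ← mul_assoc]
    gcongr
    exact norm_green_le hκ (hx.ne (Ne.symm h))

lemma sum_phi_le_alpha (hκ : 0 < κ) (hx : Function.Injective x) (i : Fin s) :
    ∑ j ∈ Finset.univ.erase i, κ ^ 2 * phi d κ ‖x i - x j‖ * ‖a j‖ ≤ alpha κ a x := by
  have h1 := phi_nonneg d κ (separation_nonneg (x := x))
  calc _ ≤ ∑ j ∈ Finset.univ.erase i, κ ^ 2 * phi d κ (separation x) * ‖a j‖ := by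
        refine Finset.sum_le_sum fun j hj => ?_
        gcongr
        exact phi_norm_sub_le hκ hx (Finset.ne_of_mem_erase hj).symm
    _ = κ ^ 2 * phi d κ (separation x) * ∑ j ∈ Finset.univ.erase i, ‖a j‖ :=
        (Finset.mul_sum _ _ _).symm
    _ ≤ alpha κ a x := by
        rw [alpha]; gcongr; exact sum_erase_le_maxRemovedL1 a i

lemma pairInteraction_eq : pairInteraction κ a x =
    ∑ i, ‖a i‖ * ∑ j ∈ Finset.univ.erase i, κ ^ 2 * phi d κ ‖x i - x j‖ * ‖a j‖ := by
  set g : Fin s → Fin s → ℝ := fun i j => ‖a i‖ * ‖a j‖ * κ ^ 2 * phi d κ ‖x i - x j‖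
  have hg : ∀ i j, g j i = g i j := fun i j => by
    simp only [g]; rw [norm_sub_rev]; ring
  have h := Finset.sum_sum_Ioi_add_eq_sum_sum_off_diag g
  calc pairInteraction κ a x = ∑ i, ∑ j ∈ Finset.Ioi i, (g j i + g i j) := by
        rw [pairInteraction, Finset.mul_sum]
        refine Finset.sum_congr rfl fun i _ => ?_
        rw [Finset.mul_sum]
        refine Finset.sum_congr rfl fun j _ => ?_
        rw [hg]; simp only [g]; ring
    _ = _ := by
        rw [h]
        refine Finset.sum_congr rfl fun i _ => ?_
        rw [Finset.mul_sum]
        refine Finset.sum_congr (by ext j; simp) fun j _ => ?_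
        rw [hg]; simp only [g]; ring

lemma pairInteraction_le (hκ : 0 < κ) (hx : Function.Injective x) :
    pairInteraction κ a x ≤ l1Norm a * alpha κ a x := by
  rw [pairInteraction_eq, l1Norm, Finset.sum_mul]
  refine Finset.sum_le_sum fun i _ => ?_
  gcongr
  exact sum_phi_le_alpha hκ hx i

lemma norm_farField_sub_le (u : Direction d → Fin s → ℂ) (p : Direction d × Direction d) :
    ‖farField κ a x u p - farFieldBorn κ a x p‖ ≤
      κ ^ 2 / (4 * Real.pi) * ∑ i, ‖a i‖ * ‖u p.2 i - incident κ p.2 (x i)‖ := by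
  have h : farField κ a x u p - farFieldBorn κ a x p = (κ : ℂ) ^ 2 / (4 * (Real.pi : ℂ)) *
      ∑ i, a i * (u p.2 i - incident κ p.2 (x i)) * Complex.exp (-(Complex.I * (κ : ℂ) *
        (inner ℝ (p.1 : EuclideanSpace ℝ (Fin d)) (x i) : ℂ))) := by
    rw [farField, farFieldBorn, ← mul_sub, ← Finset.sum_sub_distrib]
    congr 1
    refine Finset.sum_congr rfl fun i _ => ?_
    rw [inner_sub_left, incident, mul_sub, sub_mul, mul_assoc (a i) (Complex.exp _),
      ← Complex.exp_add]
    congr 3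
    push_cast; ring
  have hc : ‖(κ : ℂ) ^ 2 / (4 * (Real.pi : ℂ))‖ = κ ^ 2 / (4 * Real.pi) := by
    simp [abs_of_pos Real.pi_pos]
  have hp := Real.pi_pos
  rw [h, norm_mul, hc]
  gcongr
  refine norm_sum_le_of_le _ fun i _ => ?_
  rw [norm_mul, norm_mul, norm_exp_neg_I_mul, mul_one]

lemma supNorm_le_ofReal {X : Type*} {f : X → ℂ} {C : ℝ} (h : ∀ p, ‖f p‖ ≤ C) :
    supNorm f ≤ ENNReal.ofReal C :=
  iSup_le fun p => by
    rw [← ofReal_norm]; exact ENNReal.ofReal_le_ofReal (h p)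

end Scatterers

end FoldyLax

theorem mainTheorem2 {d s : ℕ} (hd : d = 2 ∨ d = 3) (κ : ℝ) (hκ : 0 < κ)
    (a : Fin s → ℂ) (ha : ∀ i, a i ≠ 0)
    (x : Fin s → EuclideanSpace ℝ (Fin d)) (hx : Function.Injective x)
    (hα : FoldyLax.alpha κ a x < 1) :
    (∀ θ : FoldyLax.Direction d, ∃! u : Fin s → ℂ, FoldyLax.IsFoldySolution κ a x θ u) ∧
    (∀ u : FoldyLax.Direction d → Fin s → ℂ,
      (∀ θ, FoldyLax.IsFoldySolution κ a x θ (u θ)) →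
      FoldyLax.supNorm (fun p => FoldyLax.farField κ a x u p - FoldyLax.farFieldBorn κ a x p)
        ≤ ENNReal.ofReal (κ ^ 2 / (4 * Real.pi) *
            (FoldyLax.l1Norm a * (FoldyLax.alpha κ a x / (1 - FoldyLax.alpha κ a x)))) ∧
      FoldyLax.supNorm (fun p => FoldyLax.farField κ a x u p - FoldyLax.farFieldBorn κ a x p)
        ≤ ENNReal.ofReal (κ ^ 2 / (4 * Real.pi) *
            (FoldyLax.l1Norm a * (FoldyLax.alpha κ a x ^ 2 / (1 - FoldyLax.alpha κ a x))
              + FoldyLax.pairInteraction κ a x))) ∧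
    κ ^ 2 / (4 * Real.pi) *
        (FoldyLax.l1Norm a * (FoldyLax.alpha κ a x ^ 2 / (1 - FoldyLax.alpha κ a x))
          + FoldyLax.pairInteraction κ a x)
      ≤ κ ^ 2 / (4 * Real.pi) *
        (FoldyLax.l1Norm a * (FoldyLax.alpha κ a x / (1 - FoldyLax.alpha κ a x))) := by
  open FoldyLax in
  have hp := Real.pi_pos
  have h0 : 0 ≤ alpha κ a x := alpha_nonneg
  have hM : ∀ i, ∑ j, ‖foldyMatrix κ a x i j‖ ≤ alpha κ a x := fun i =>
    (sum_norm_foldyMatrix_le hκ hx i).trans (sum_phi_le_alpha hκ hx i)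
  have hf : ∀ (θ : Direction d) i, ‖incident κ θ (x i)‖ ≤ 1 := fun θ i => (norm_incident θ _).le
  refine ⟨fun θ => ?_, fun u hu => ⟨supNorm_le_ofReal fun p => ?_, supNorm_le_ofReal fun p => ?_⟩,
    ?_⟩
  · simp only [isFoldySolution_iff]
    exact existsUnique_system hM h0 hα _
  · refine (norm_farField_sub_le u p).trans ?_
    rw [l1Norm, Finset.sum_mul]
    gcongr with i
    exact norm_sub_le_of_system hM h0 hα (hf p.2) ((isFoldySolution_iff _ _).1 (hu p.2)) i
  · refine (norm_farField_sub_le u p).trans ?_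
    rw [l1Norm, Finset.sum_mul, pairInteraction_eq, ← Finset.sum_add_distrib]
    gcongr with i
    rw [← mul_add]
    gcongr
    refine (norm_sub_le_sq_add_of_system hM h0 hα (hf p.2)
      ((isFoldySolution_iff _ _).1 (hu p.2)) i).trans ?_
    gcongr
    exact sum_norm_foldyMatrix_le hκ hx i
  · have h1 : (1 : ℝ) - alpha κ a x ≠ 0 := (sub_pos.2 hα).ne'
    have h2 : l1Norm a * (alpha κ a x / (1 - alpha κ a x)) =
        l1Norm a * (alpha κ a x ^ 2 / (1 - alpha κ a x)) + l1Norm a * alpha κ a x := by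
      field_simp; ring
    rw [h2]
    gcongr
    exact pairInteraction_le hκ hx
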